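/- Let $k$ be a field of characteristic $\neq 2$, let $f \in k[x]$ be squarefree of odd degree $2g+1$ with leading coefficient $c$, let $C$ be the hyperelliptic curve $y^2 = f(x)$ with its unique point $\infty$ at infinity, and let $J$ be its Jacobian; $J(k)$ is the group of divisors of degree $0$ on $C$ over $k$ modulo principal divisors. For a monic polynomial $a \in k[x]$ and $b \in k[x]$ with $a \mid f - b^2$, let $(a,b)$ be the effective divisor on the affine part of $C$ given by $a(x) = 0$, $y = b(x)$ (it has degree $\deg a$), and let $[a,b] \in J(k)$ be the class of $(a,b) - \deg(a)\,\infty$. All gcds are monic, and $\deg 0 = -\infty$. Let $a \in k[x]$ be monic and squarefree, of degree $\le 2g+1$. Let $d = \gcd(a,f)$ and write $a = d a_1$, $f = d f_1$. Let $b, s \in k[x]$ satisfy \[ f \equiv b^2 \bmod a \qquad\text{and}\qquad (-c)^{\deg(a)}(a - a_1 f_1) \equiv s^2 \bmod f . \] Put $P = [a,b]$; then $P \in 2J(k)$. Consider, for $u, v, w \in k[x]$, the system \[ v d \equiv w s \bmod f_1, \quad v d \equiv u b \bmod a_1, \quad u f_1 \equiv w s \bmod d \tag{1} \] with the restrictions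 \[ w \text{ monic},\quad \deg(u) < \deg(a)/2, \quad \deg(v) \le g + \deg(a)/2 - \deg(d), \quad \deg(w) \le g . \tag{2} \] (i) The system (1) has a solution $(u,v,w)$ that satisfies (2). (ii) Every solution of (1) that satisfies (2) satisfies $u^2 f_1 = d v^2 - (-c)^{\deg(a)} a_1 w^2$. (iii) Let $(u,v,w)$ be a solution of (1) satisfying (2) such that $w$ has minimal degree among all such solutions. Let $d_1 = \gcd(u,w)$, $d_f = \gcd(d_1,f)$, $d_a = \gcd(d_1,a_1)$. Then $d_1$ divides $f a_1$ and $v$, and $d_1 = d_f d_a$. Set $u_1 = u/d_1$, $v_1 = v/d_1$, $w_1 = w/d_1$. There is $r \in k[x]$ such that \[ r u_1 \equiv -v_1 d \bmod w_1 d_a \qquad\text{and}\qquad r \equiv 0 \bmod d_f , \tag{3} \] and for every such $r$ one has $w \mid f - r^2$, and the point $Q = [w,r]$ satisfies $P = 2Q$. (iv) Let $s' \in k[x]$ also satisfy $(-c)^{\deg(a)}(a - a_1 f_1) \equiv s'^2 \bmod f$, and suppose that $s' \not\equiv \pm s \bmod f$ (that is, $s' \not\equiv s$ and $s' \not\equiv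 -s$). If $Q = [w,r]$ and $Q' = [w',r']$ are obtained as in (iii) from $s$ and $s'$, respectively (with the same $a$ and $b$), then $Q \neq Q'$. -/

import Mathlib

open Polynomial

/-- The hyperelliptic curve `y ^ 2 = f(x)` of odd degree over a field `k` of characteristic `≠ 2`,
with `f` squarefree of degree `2 * g + 1`. -/
structure OddHyperellipticCurve (k : Type*) [Field k] where
  g : ℕ
  f : k[X]
  squarefree : Squarefree f
  natDegree_eq : f.natDegree = 2 * g + 1
  two_ne_zero : (2 : k) ≠ 0

namespace OddHyperellipticCurve

variable {k : Type*} [Field k] (C : OddHyperellipticCurve k)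

/-- The ring `k[x, y] / (y ^ 2 - f(x))` of regular functions on the affine part of the curve,
the complement of the unique point `∞` at infinity; `⟨p, q⟩` stands for `p(x) + q(x) * y`. -/
abbrev CoordinateRing : Type _ := QuadraticAlgebra k[X] C.f 0

theorem f_ne_zero : C.f ≠ 0 := C.squarefree.ne_zero

theorem norm_ne_zero {z : C.CoordinateRing} (hz : z ≠ 0) : z.norm ≠ 0 := by
  intro h
  rw [QuadraticAlgebra.norm_def] at h
  have h' : z.re * z.re = C.f * (z.im * z.im) := by linear_combination h
  by_cases hi : z.im = 0
  · have : z.re = 0 := by simpa [hi] using h'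
    exact hz (QuadraticAlgebra.ext this hi)
  · have hr : z.re ≠ 0 := by
      rintro h0
      rw [h0] at h'
      simp [C.f_ne_zero, hi] at h'
    have := congrArg natDegree h'
    rw [natDegree_mul hr hr, natDegree_mul C.f_ne_zero (mul_ne_zero hi hi),
      natDegree_mul hi hi, C.natDegree_eq] at this
    omega

instance : IsDomain C.CoordinateRing :=
  haveI : NoZeroDivisors C.CoordinateRing := ⟨fun {x y} h => by
    by_contra! hxy
    have := congrArg QuadraticAlgebra.norm h
    rw [map_mul, QuadraticAlgebra.norm_zero] at this
    exact mul_ne_zero (C.norm_ne_zero hxy.1) (C.norm_ne_zero hxy.2) this⟩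
  NoZeroDivisors.to_isDomain _

theorem dvd_of_sq_dvd {A : Type*} [EuclideanDomain A] {p n m : A} (hp : Squarefree p) (hn : n ≠ 0)
    (h : n ^ 2 ∣ p * m ^ 2) : n ∣ m := by
  classical
  obtain ⟨n', hn'⟩ := EuclideanDomain.gcd_dvd_left n m
  obtain ⟨m', hm'⟩ := EuclideanDomain.gcd_dvd_right n m
  set e := EuclideanDomain.gcd n m
  have he : e ≠ 0 := by rintro h0; rw [h0, zero_mul] at hn'; exact hn hn'
  have hcop : IsCoprime n' m' := by
    have := EuclideanDomain.gcd_eq_gcd_ab n m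
    refine ⟨EuclideanDomain.gcdA n m, EuclideanDomain.gcdB n m, mul_left_cancel₀ he ?_⟩
    calc _ = (e * n') * EuclideanDomain.gcdA n m + (e * m') * EuclideanDomain.gcdB n m := by ring
      _ = _ := by rw [← hn', ← hm', ← this, mul_one]
  rw [hn', hm', mul_pow, mul_pow, mul_left_comm, mul_dvd_mul_iff_left (pow_ne_zero 2 he)] at h
  have hu : IsUnit n' := hp n' (by
    rw [← pow_two]; exact (hcop.pow (m := 2) (n := 2)).dvd_of_dvd_mul_right h)
  rw [hn', hm']
  exact mul_dvd_mul_left e hu.dvd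

theorem dvd_of_isIntegral {A L : Type*} [CommRing A] [IsDomain A] [IsIntegrallyClosed A]
    [Field L] [Algebra A L] [FaithfulSMul A L] {p n : A} (hn : n ≠ 0)
    {t : L} (ht : algebraMap A L n * t = algebraMap A L p) (hi : IsIntegral A t) : n ∣ p := by
  let F := FractionRing A
  let _ : Algebra F L := FractionRing.liftAlgebra A L
  have : IsScalarTower A F L := FractionRing.isScalarTower_liftAlgebra A L
  have hnF : algebraMap A F n ≠ 0 := by simpa using hn
  have hnL : algebraMap A L n ≠ 0 := by simpa using hn
  have htq : algebraMap F L (algebraMap A F p / algebraMap A F n) = t := by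
    rw [map_div₀, ← IsScalarTower.algebraMap_apply, ← IsScalarTower.algebraMap_apply, ← ht]
    field_simp
  rw [← htq] at hi
  have := (isIntegral_algebraMap_iff (FaithfulSMul.algebraMap_injective F L)).mp hi
  obtain ⟨q, hq⟩ := IsIntegrallyClosed.algebraMap_eq_of_integral this
  refine ⟨q, FaithfulSMul.algebraMap_injective A F ?_⟩
  rw [map_mul, hq, mul_div_cancel₀ _ hnF]

instance : IsNoetherianRing C.CoordinateRing :=
  IsNoetherianRing.of_finite k[X] _

instance : Ring.DimensionLEOne C.CoordinateRing :=
  Ring.DimensionLEOne.of_isIntegral k[X] _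

theorem exists_eq_of_isIntegral {L : Type*} [Field L] [Algebra C.CoordinateRing L]
    [IsFractionRing C.CoordinateRing L] [Algebra k[X] L] [IsScalarTower k[X] C.CoordinateRing L]
    [FaithfulSMul k[X] L] (x : L) (hx : IsIntegral C.CoordinateRing x) :
    ∃ y, algebraMap C.CoordinateRing L y = x := by
  have hx' : IsIntegral k[X] x := isIntegral_trans x hx
  obtain ⟨z, n, hn, hz⟩ : ∃ (z : C.CoordinateRing) (n : k[X]), n ≠ 0 ∧
      algebraMap k[X] L n * x = algebraMap C.CoordinateRing L z := by
    obtain ⟨z₀, w, hw, rfl⟩ := IsFractionRing.div_surjective (A := C.CoordinateRing) x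
    have hw0 : w ≠ 0 := nonZeroDivisors.ne_zero hw
    have hw1 : algebraMap C.CoordinateRing L w ≠ 0 := by simpa using hw0
    refine ⟨z₀ * star w, w.norm, C.norm_ne_zero hw0, ?_⟩
    rw [IsScalarTower.algebraMap_apply k[X] C.CoordinateRing L, QuadraticAlgebra.algebraMap_norm_eq_mul_star,
      map_mul, map_mul]
    field_simp
  have hnL : algebraMap k[X] L n ≠ 0 := by simpa using hn
  have hinj : Function.Injective (starRingEnd C.CoordinateRing) := star_injective
  let σ : L →+* L := IsFractionRing.map hinj
  have hσ : ∀ y : C.CoordinateRing, σ (algebraMap C.CoordinateRing L y) = algebraMap C.CoordinateRing L (star y) := fun y =>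
    IsLocalization.map_eq _ y
  have hσk : ∀ p : k[X], σ (algebraMap k[X] L p) = algebraMap k[X] L p := fun p => by
    rw [IsScalarTower.algebraMap_apply k[X] C.CoordinateRing L, hσ]
    congr 1
    refine QuadraticAlgebra.ext ?_ ?_ <;> simp
  have hσx : IsIntegral k[X] (σ x) :=
    hx'.map_of_comp_eq (RingHom.id _) σ (by ext p <;> simp [hσk])
  have hz' : algebraMap k[X] L n * σ x = algebraMap C.CoordinateRing L (star z) := by
    rw [← hσ, ← hz, map_mul, hσk]
  have htr : n ∣ z.re := by
    have h1 : n ∣ 2 * z.re := by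
      refine dvd_of_isIntegral hn (t := x + σ x) ?_ (hx'.add hσx)
      rw [mul_add, hz, hz', ← map_add, IsScalarTower.algebraMap_apply k[X] C.CoordinateRing L]
      congr 1
      refine QuadraticAlgebra.ext ?_ ?_ <;> simp
      ring
    have h2 : IsUnit (2 : k[X]) := by
      simpa only [map_ofNat] using
        (isUnit_iff_ne_zero.mpr C.two_ne_zero).map (Polynomial.C : k →+* k[X])
    exact (h2.dvd_mul_left).mp h1
  have hnm : n ^ 2 ∣ z.norm := by
    refine dvd_of_isIntegral (pow_ne_zero 2 hn) (t := x * σ x) ?_ (hx'.mul hσx)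
    rw [IsScalarTower.algebraMap_apply k[X] C.CoordinateRing L z.norm, QuadraticAlgebra.algebraMap_norm_eq_mul_star,
      map_mul, ← hz, ← hz', map_pow]
    ring
  have him : n ∣ z.im := by
    refine dvd_of_sq_dvd C.squarefree hn ?_
    have : C.f * z.im ^ 2 = z.re ^ 2 - z.norm := by
      rw [QuadraticAlgebra.norm_def]; ring
    rw [this]
    exact dvd_sub (pow_dvd_pow_of_dvd htr 2) hnm
  obtain ⟨p, hp⟩ := htr
  obtain ⟨q, hq⟩ := him
  refine ⟨⟨p, q⟩, mul_left_cancel₀ hnL ?_⟩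
  rw [hz, IsScalarTower.algebraMap_apply k[X] C.CoordinateRing L, ← map_mul]
  congr 1
  refine QuadraticAlgebra.ext ?_ ?_ <;> simp [hp, hq]

instance : IsDedekindDomain C.CoordinateRing :=
  (isDedekindDomain_iff _ (FractionRing C.CoordinateRing)).mpr
    ⟨inferInstance, inferInstance, inferInstance, fun {x} hx => C.exists_eq_of_isIntegral x hx⟩

/-- The regular function `y - b(x)`. -/
noncomputable def ySub (b : k[X]) : C.CoordinateRing := ⟨-b, 1⟩

/-- The group of divisors on the complete curve: the free abelian group on its closed points,
which are the maximal ideals of the affine coordinate ring and the point `∞`.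
The second component is the coefficient at `∞`. -/
abbrev Divisor : Type _ := (IsDedekindDomain.HeightOneSpectrum C.CoordinateRing →₀ ℤ) × ℤ

/-- The point at infinity as a divisor. -/
def infinity : C.Divisor := (0, 1)

/-- The degree of a divisor. A closed point has degree the `k`-dimension of its residue field;
`∞` is a `k`-rational point. -/
noncomputable def degree : C.Divisor →+ ℤ :=
  (Finsupp.liftAddHom fun v : IsDedekindDomain.HeightOneSpectrum C.CoordinateRing =>
      (AddMonoidHom.mulRight (Module.finrank k (C.CoordinateRing ⧸ v.asIdeal) : ℤ))).coprod
    (AddMonoidHom.id ℤ)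

/-- The effective divisor on the affine part that is cut out by the ideal `I ≠ 0`: the coefficient
at `v` is the exponent of `v` in the factorization of `I` into prime ideals. -/
noncomputable def idealDivisor (I : Ideal C.CoordinateRing) : C.Divisor :=
  open Classical in
  ((((UniqueFactorizationMonoid.normalizedFactors I).toFinsupp.comapDomain
    IsDedekindDomain.HeightOneSpectrum.asIdeal
      (fun _ _ _ _ h => IsDedekindDomain.HeightOneSpectrum.ext h)).mapRange (Nat.cast : ℕ → ℤ)
        Nat.cast_zero), 0)

/-- The divisor of a nonzero regular function `h = p(x) + q(x) * y` on the affine part. Its order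
at `∞` is minus the degree of the norm `p ^ 2 - f * q ^ 2` of `h` to `k[x]`, that is,
`- max (2 * deg p) (2 * deg q + 2 * g + 1)`: `x` and `y` have poles of order `2` and `2 * g + 1`. -/
noncomputable def div (h : C.CoordinateRing) : C.Divisor :=
  C.idealDivisor (Ideal.span {h}) - (h.norm.natDegree : ℤ) • C.infinity

/-- The group of divisors of nonzero rational functions. Every such function is a quotient
`h₁ / h₂` of nonzero regular functions on the affine part, and its divisor is `div h₁ - div h₂`. -/
noncomputable def principalDivisors : AddSubgroup C.Divisor :=
  AddSubgroup.closure {D | ∃ h : C.CoordinateRing, h ≠ 0 ∧ D = C.div h}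

/-- The group of divisors of degree `0`. -/
noncomputable def degreeZero : AddSubgroup C.Divisor := C.degree.ker

/-- The group `J(k)` of `k`-rational points of the Jacobian, as the group of divisors of degree `0`
modulo principal divisors (the curve has the `k`-rational point `∞`). -/
abbrev Jacobian : Type _ := C.degreeZero ⧸ C.principalDivisors.addSubgroupOf C.degreeZero

/-- The class of `D - deg(D) * ∞` in `J(k)`. -/
noncomputable def toJacobian (D : C.Divisor) : C.Jacobian :=
  QuotientAddGroup.mk ⟨D - C.degree D • C.infinity, by
    simp [degreeZero, AddMonoidHom.mem_ker, degree, infinity]⟩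

/-- The effective divisor `(a, b)` with Mumford representation `a`, `b`, where `a` is monic and
divides `f - b ^ 2`: it is cut out by `a(x) = 0`, `y = b(x)`. -/
noncomputable def mumfordDivisor (a b : k[X]) : C.Divisor :=
  C.idealDivisor (Ideal.span {algebraMap k[X] C.CoordinateRing a, C.ySub b})

/-- The point `[a, b] = [(a, b) - deg (a, b) * ∞]` of `J(k)`. -/
noncomputable def mumfordPoint (a b : k[X]) : C.Jacobian :=
  C.toJacobian (C.mumfordDivisor a b)

end OddHyperellipticCurve

/-- The monic greatest common divisor of two polynomials (`0` if both are `0`). -/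
noncomputable def monicGcd {k : Type*} [Field k] (p q : k[X]) : k[X] :=
  open Classical in normalize (EuclideanDomain.gcd p q)

namespace OddHyperellipticCurve

variable {k : Type*} [Field k] (C : OddHyperellipticCurve k)

/-- `s ^ 2 ≡ (-c) ^ deg a * (a - a₁ * f₁) mod f`, where `c` is the leading coefficient of `f`. -/
def IsSqrt (a a₁ f₁ s : k[X]) : Prop :=
  C.f ∣ Polynomial.C ((-C.f.leadingCoeff) ^ a.natDegree) * (a - a₁ * f₁) - s ^ 2

/-- `(u, v, w)` solves the congruences `v d ≡ w s mod f₁`, `v d ≡ u b mod a₁`, `u f₁ ≡ w s mod d`,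
`w` is monic (so the solution is nontrivial), and `deg u < deg a / 2`,
`deg v ≤ g + deg a / 2 - deg d`, `deg w ≤ g`, where the zero polynomial has degree `-∞`. -/
structure IsSolution (a b d a₁ f₁ s u v w : k[X]) : Prop where
  congr_f₁ : f₁ ∣ v * d - w * s
  congr_a₁ : a₁ ∣ v * d - u * b
  congr_d : d ∣ u * f₁ - w * s
  monic : w.Monic
  degree_u : u ≠ 0 → 2 * u.natDegree < a.natDegree
  degree_v : v ≠ 0 → 2 * v.natDegree + 2 * d.natDegree ≤ 2 * C.g + a.natDegree
  degree_w : w.natDegree ≤ C.g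

/-- A solution in which `w` has minimal degree. -/
structure IsMinimalSolution (a b d a₁ f₁ s u v w : k[X]) : Prop where
  isSolution : C.IsSolution a b d a₁ f₁ s u v w
  minimal : ∀ u' v' w', C.IsSolution a b d a₁ f₁ s u' v' w' → w.natDegree ≤ w'.natDegree

/-- With `d₁ = gcd (u, w)`, `d_f = gcd (d₁, f)`, `d_a = gcd (d₁, a₁)` and `u₁ = u / d₁`,
`v₁ = v / d₁`, `w₁ = w / d₁`: the congruences `r u₁ ≡ -v₁ d mod w₁ d_a` and `r ≡ 0 mod d_f`. -/
def IsMumfordR (d a₁ u v w r : k[X]) : Prop :=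
  w / monicGcd u w * monicGcd (monicGcd u w) a₁ ∣
      r * (u / monicGcd u w) - -(v / monicGcd u w * d) ∧
    monicGcd (monicGcd u w) C.f ∣ r

end OddHyperellipticCurve

/-! Put γ = (-c)^(deg a), which enters only as a unit. For a solution (u,v,w) the function h = v d -
u y has norm (v d)² - u² f = d (d v² - u² f₁), and by the relation in (ii) this equals γ a w². The
congruences refine this equality of norms to an equality of ideals, (h) = (a,b) (w,-r)² (`span_eq`).
As h has poles only at ∞, P + 2[w,-r] = 0, so P = 2[w,r].

The relation holds modulo each of d, a₁, f₁ by the congruences, and the degree bounds turn this into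
an equality (`relation`). A solution exists because the bounds leave one more coefficient than there
are linear conditions (`exists_isSolution`).

The delicate point is G = gcd(u,w), which divides v but cannot simply be cancelled from the
congruences. Minimality of deg w says that no nonconstant factor of G can be cancelled. Hence G
divides f a₁, and modulo the gcds of G with a₁, f₁, d the congruences for u/G, v/G, w/G hold with
the opposite sign (`monicGcd_a₁_dvd`, `monicGcd_f₁_dvd`, `monicGcd_d_dvd`).

For (iv), a reduced divisor is determined by its class, so Q = Q' gives (h) = (h'). Units of
k[x,y]/(y² - f) are constants, and the relation leaves only the constants ±1. A minimal solution
determines s modulo f (`dvd_sub_of_same`), so s' ≡ ±s. -/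

/-! ### Divisors of ideals, their degrees, and classes in J(k). -/

/-- In a Dedekind domain over a field, codimension is additive under multiplication of an ideal
by a maximal ideal. -/
theorem Ideal.finrank_quotient_isMaximal_mul {k R : Type*} [Field k] [CommRing R]
    [IsDedekindDomain R] [Algebra k R] {P I : Ideal R} (hP : P.IsMaximal) (hP0 : P ≠ ⊥)
    (hI : I ≠ ⊥) [Module.Finite k (R ⧸ P * I)] :
    Module.finrank k (R ⧸ P * I) = Module.finrank k (R ⧸ P) + Module.finrank k (R ⧸ I) := by
  obtain ⟨c, hc⟩ := IsDedekindDomain.exists_sup_span_eq (Ideal.mul_le_right : P * I ≤ I)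
    (mul_ne_zero hP0 hI)
  have hcI : c ∈ I := hc ▸ Ideal.mem_sup_right (Ideal.mem_span_singleton_self c)
  have hcPI : c ∉ P * I := by
    intro h
    rw [sup_eq_left.mpr ((Ideal.span_singleton_le_iff_mem _).mpr h)] at hc
    exact hP.ne_top (mul_right_cancel₀ hI (by rw [hc, ← Ideal.one_eq_top, one_mul]))
  -- Since I = P I + (c), multiplication by c identifies R/P with I/PI, the kernel of R/PI → R/I.
  let φ : R →ₗ[R] R ⧸ P * I := (Submodule.mkQ (P * I)).comp (LinearMap.mulLeft R c)
  have hφ : ∀ x, φ x = Ideal.Quotient.mk (P * I) (c * x) := fun x => rfl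
  have hker : LinearMap.ker φ = P := by
    refine (hP.eq_of_le ?_ ?_).symm
    · intro h
      have : (1 : R) ∈ LinearMap.ker φ := by rw [h]; trivial
      rw [LinearMap.mem_ker, hφ, mul_one, Ideal.Quotient.eq_zero_iff_mem] at this
      exact hcPI this
    · intro x hx
      rw [LinearMap.mem_ker, hφ, Ideal.Quotient.eq_zero_iff_mem, mul_comm c x]
      exact Ideal.mul_mem_mul hx hcI
  let ψ : (R ⧸ P * I) →ₐ[k] R ⧸ I := Ideal.Quotient.factorₐ k Ideal.mul_le_right
  have hψ : Function.Surjective ψ := Ideal.Quotient.factor_surjective Ideal.mul_le_right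
  let φ' : R →ₗ[k] R ⧸ P * I := φ.restrictScalars k
  have hrange : LinearMap.range φ' = LinearMap.ker ψ.toLinearMap := by
    ext x
    obtain ⟨x, rfl⟩ := Ideal.Quotient.mk_surjective x
    have h1 : Ideal.Quotient.mk (P * I) x ∈ LinearMap.ker ψ.toLinearMap ↔ x ∈ I := by
      rw [LinearMap.mem_ker]
      exact Ideal.Quotient.eq_zero_iff_mem
    rw [h1]
    constructor
    · rintro ⟨y, hy⟩
      have hy : Ideal.Quotient.mk (P * I) (c * y) = Ideal.Quotient.mk (P * I) x := hy
      rw [Ideal.Quotient.eq] at hy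
      have := I.sub_mem (I.mul_mem_right y hcI) (Ideal.mul_le_right hy)
      rwa [sub_sub_cancel] at this
    · intro hx
      rw [← hc] at hx
      obtain ⟨z, hz, y, hy, rfl⟩ := Submodule.mem_sup.mp hx
      obtain ⟨y, rfl⟩ := Ideal.mem_span_singleton'.mp hy
      refine ⟨y, ?_⟩
      change Ideal.Quotient.mk (P * I) (c * y) = _
      rw [Ideal.Quotient.eq]
      have := (P * I).neg_mem hz
      convert this using 1
      ring
  have h1 := LinearMap.finrank_range_add_finrank_ker ψ.toLinearMap
  rw [LinearMap.range_eq_top.mpr hψ, finrank_top, ← hrange] at h1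
  let e : (R ⧸ P) ≃ₗ[k] LinearMap.range φ' :=
    ((Submodule.quotEquivOfEq _ _ hker.symm).restrictScalars k).trans
      (φ.quotKerEquivRange.restrictScalars k)
  have h2 := e.finrank_eq
  omega

namespace OddHyperellipticCurve

variable {k : Type*} [Field k] (C : OddHyperellipticCurve k)

theorem finite_quotient {I : Ideal C.CoordinateRing} (hI : I ≠ ⊥) :
    Module.Finite k (C.CoordinateRing ⧸ I) :=
  Module.Finite.equiv (Ideal.quotientEquivDirectSum k (QuadraticAlgebra.basis C.f 0) hI).symm

theorem norm_eq_algebraNorm (h : C.CoordinateRing) : Algebra.norm k[X] h = h.norm := by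
  rw [Algebra.norm_apply]
  exact QuadraticAlgebra.det_toLinearMap_eq_norm h

theorem finrank_quotient_span {h : C.CoordinateRing} (hh : h ≠ 0) :
    Module.finrank k (C.CoordinateRing ⧸ Ideal.span {h}) = h.norm.natDegree := by
  rw [finrank_quotient_span_eq_natDegree_norm (QuadraticAlgebra.basis C.f 0) hh,
    norm_eq_algebraNorm]

open Classical in
theorem idealDivisor_fst_apply (I : Ideal C.CoordinateRing)
    (v : IsDedekindDomain.HeightOneSpectrum C.CoordinateRing) :
    (C.idealDivisor I).1 v = (UniqueFactorizationMonoid.normalizedFactors I).count v.asIdeal := by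
  rw [idealDivisor, Finsupp.mapRange_apply]
  exact congrArg Nat.cast (Multiset.toFinsupp_apply _ _)

theorem idealDivisor_mul {I J : Ideal C.CoordinateRing} (hI : I ≠ ⊥) (hJ : J ≠ ⊥) :
    C.idealDivisor (I * J) = C.idealDivisor I + C.idealDivisor J := by
  classical
  refine Prod.ext (Finsupp.ext fun v => ?_) (by simp [idealDivisor])
  simp [idealDivisor_fst_apply, UniqueFactorizationMonoid.normalizedFactors_mul hI hJ]

theorem idealDivisor_top : C.idealDivisor ⊤ = 0 := by
  classical
  refine Prod.ext (Finsupp.ext fun v => ?_) (by simp [idealDivisor])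
  simp [idealDivisor_fst_apply, ← Ideal.one_eq_top]

theorem eq_of_idealDivisor_eq {I J : Ideal C.CoordinateRing} (hI : I ≠ ⊥) (hJ : J ≠ ⊥)
    (h : (C.idealDivisor I).1 = (C.idealDivisor J).1) : I = J := by
  classical
  rw [← associated_iff_eq,
    UniqueFactorizationMonoid.associated_iff_normalizedFactors_eq_normalizedFactors hI hJ]
  ext P
  by_cases hP : Prime P
  · have := DFunLike.congr_fun h ⟨P, Ideal.isPrime_of_prime hP, hP.ne_zero⟩
    simpa [idealDivisor_fst_apply] using this
  · rw [Multiset.count_eq_zero_of_notMem, Multiset.count_eq_zero_of_notMem] <;>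
    exact fun h => hP (UniqueFactorizationMonoid.prime_of_normalized_factor _ h)

theorem idealDivisor_asIdeal (v : IsDedekindDomain.HeightOneSpectrum C.CoordinateRing) :
    C.idealDivisor v.asIdeal = (Finsupp.single v 1, 0) := by
  classical
  refine Prod.ext (Finsupp.ext fun w => ?_) (by simp [idealDivisor])
  rw [idealDivisor_fst_apply, UniqueFactorizationMonoid.normalizedFactors_irreducible v.irreducible,
    normalize_eq, Finsupp.single_apply, Multiset.count_singleton]
  simp [IsDedekindDomain.HeightOneSpectrum.ext_iff, eq_comm]

theorem degree_idealDivisor {I : Ideal C.CoordinateRing} (hI : I ≠ ⊥) :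
    C.degree (C.idealDivisor I) = Module.finrank k (C.CoordinateRing ⧸ I) := by
  induction I using UniqueFactorizationMonoid.induction_on_prime with
  | h₁ => exact absurd rfl hI
  | h₂ I hu =>
    rw [Ideal.isUnit_iff] at hu
    subst hu
    have : Subsingleton (C.CoordinateRing ⧸ (⊤ : Ideal C.CoordinateRing)) :=
      Ideal.Quotient.subsingleton_iff.mpr rfl
    rw [idealDivisor_top, map_zero, Module.finrank_zero_of_subsingleton, Nat.cast_zero]
  | h₃ I P hI0 hP ih =>
    have := C.finite_quotient hI
    have hmax := (Ideal.isPrime_of_prime hP).isMaximal hP.ne_zero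
    rw [idealDivisor_mul C hP.ne_zero hI0, map_add, ih hI0,
      Ideal.finrank_quotient_isMaximal_mul hmax hP.ne_zero hI0, Nat.cast_add,
      C.idealDivisor_asIdeal ⟨P, Ideal.isPrime_of_prime hP, hP.ne_zero⟩]
    simp [degree]

theorem toJacobian_add (D E : C.Divisor) :
    C.toJacobian (D + E) = C.toJacobian D + C.toJacobian E := by
  rw [toJacobian, toJacobian, toJacobian, ← QuotientAddGroup.mk_add]
  congr 1
  refine Subtype.ext ?_
  simp only [map_add, add_smul, AddSubgroup.coe_add]
  abel

/-- The codimension of (h) is the degree of the norm of h, so subtracting degree times ∞ gives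
exactly `div h`. -/
theorem toJacobian_idealDivisor_span {h : C.CoordinateRing} (hh : h ≠ 0) :
    C.toJacobian (C.idealDivisor (Ideal.span {h})) = 0 := by
  rw [toJacobian, QuotientAddGroup.eq_zero_iff, AddSubgroup.mem_addSubgroupOf]
  refine AddSubgroup.subset_closure ⟨h, hh, ?_⟩
  change C.idealDivisor _ - C.degree (C.idealDivisor _) • C.infinity = _
  rw [div, C.degree_idealDivisor (by simpa using hh), C.finrank_quotient_span hh]

theorem div_mul {h h' : C.CoordinateRing} (hh : h ≠ 0) (hh' : h' ≠ 0) :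
    C.div (h * h') = C.div h + C.div h' := by
  rw [div, div, div, ← Ideal.span_singleton_mul_span_singleton,
    C.idealDivisor_mul (by simpa using hh) (by simpa using hh'), map_mul,
    natDegree_mul (C.norm_ne_zero hh) (C.norm_ne_zero hh'), Nat.cast_add, add_smul]
  abel

theorem div_one : C.div 1 = 0 := by
  rw [div, Ideal.span_singleton_one, idealDivisor_top]
  simp

/-- As `div` is additive on products, all inverses can be gathered into one denominator; no function
field is needed. -/
theorem exists_of_mem_principalDivisors {D : C.Divisor} (hD : D ∈ C.principalDivisors) :
    ∃ h₁ h₂ : C.CoordinateRing, h₁ ≠ 0 ∧ h₂ ≠ 0 ∧ D + C.div h₂ = C.div h₁ := by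
  induction hD using AddSubgroup.closure_induction with
  | mem D h =>
    obtain ⟨h, hh, rfl⟩ := h
    exact ⟨h, 1, hh, one_ne_zero, by rw [div_one, add_zero]⟩
  | zero => exact ⟨1, 1, one_ne_zero, one_ne_zero, by rw [zero_add]⟩
  | add D E _ _ hD hE =>
    obtain ⟨h₁, h₂, hh₁, hh₂, h⟩ := hD
    obtain ⟨h₁', h₂', hh₁', hh₂', h'⟩ := hE
    refine ⟨h₁ * h₁', h₂ * h₂', mul_ne_zero hh₁ hh₁', mul_ne_zero hh₂ hh₂', ?_⟩
    rw [C.div_mul hh₁ hh₁', C.div_mul hh₂ hh₂', ← h, ← h']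
    abel
  | neg D _ hD =>
    obtain ⟨h₁, h₂, hh₁, hh₂, h⟩ := hD
    exact ⟨h₂, h₁, hh₂, hh₁, by rw [← h]; abel⟩

/-- Ideals whose divisors have the same class in `J(k)` have the same ideal class. -/
theorem exists_span_mul_eq_of_toJacobian_eq {I J : Ideal C.CoordinateRing} (hI : I ≠ ⊥)
    (hJ : J ≠ ⊥) (h : C.toJacobian (C.idealDivisor I) = C.toJacobian (C.idealDivisor J)) :
    ∃ h₁ h₂ : C.CoordinateRing, h₁ ≠ 0 ∧ h₂ ≠ 0 ∧
      I * Ideal.span {h₂} = J * Ideal.span {h₁} := by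
  rw [toJacobian, toJacobian, eq_comm, QuotientAddGroup.eq, AddSubgroup.mem_addSubgroupOf] at h
  obtain ⟨h₁, h₂, hh₁, hh₂, h⟩ := C.exists_of_mem_principalDivisors h
  have hs₁ : Ideal.span {h₁} ≠ ⊥ := by simpa using hh₁
  have hs₂ : Ideal.span {h₂} ≠ ⊥ := by simpa using hh₂
  refine ⟨h₁, h₂, hh₁, hh₂, C.eq_of_idealDivisor_eq (mul_ne_zero hI hs₂) (mul_ne_zero hJ hs₁) ?_⟩
  have h' := congrArg Prod.fst h
  simp only [div, infinity, AddSubgroup.coe_add, AddSubgroup.coe_neg, Prod.fst_add, Prod.fst_sub,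
    Prod.fst_neg, Prod.smul_fst, smul_zero, sub_zero] at h'
  rw [C.idealDivisor_mul hI hs₂, C.idealDivisor_mul hJ hs₁, Prod.fst_add, Prod.fst_add, ← h']
  abel

end OddHyperellipticCurve

/-! ### Arithmetic of Mumford ideals and uniqueness of reduced representations. -/

namespace OddHyperellipticCurve

variable {k : Type*} [Field k] (C : OddHyperellipticCurve k)

/-- The ideal of the affine coordinate ring generated by `a(x)` and `y - b(x)`. -/
noncomputable def mumfordIdeal (a b : k[X]) : Ideal C.CoordinateRing :=
  Ideal.span {algebraMap k[X] C.CoordinateRing a, C.ySub b}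

theorem mumfordPoint_eq (a b : k[X]) :
    C.mumfordPoint a b = C.toJacobian (C.idealDivisor (C.mumfordIdeal a b)) := rfl

theorem isUnit_two (C : OddHyperellipticCurve k) : IsUnit (2 : k[X]) := by
  simpa only [map_ofNat] using
    (isUnit_iff_ne_zero.mpr C.two_ne_zero).map (Polynomial.C : k →+* k[X])

theorem mem_mumfordIdeal {a b : k[X]} (h : a ∣ C.f - b ^ 2) {z : C.CoordinateRing} :
    z ∈ C.mumfordIdeal a b ↔ a ∣ z.re + z.im * b := by
  rw [mumfordIdeal, Ideal.mem_span_pair]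
  constructor
  · rintro ⟨p, q, rfl⟩
    obtain ⟨c, hc⟩ := h
    refine ⟨p.re + p.im * b + q.im * c, ?_⟩
    simp only [ySub, QuadraticAlgebra.re_add, QuadraticAlgebra.im_add, QuadraticAlgebra.re_mul,
      QuadraticAlgebra.im_mul, QuadraticAlgebra.algebraMap_re, QuadraticAlgebra.algebraMap_im]
    linear_combination q.im * hc
  · rintro ⟨c, hc⟩
    refine ⟨algebraMap _ _ c, algebraMap _ _ z.im, QuadraticAlgebra.ext ?_ ?_⟩
    · simp only [ySub, QuadraticAlgebra.re_add, QuadraticAlgebra.re_mul,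
        QuadraticAlgebra.algebraMap_re, QuadraticAlgebra.algebraMap_im]
      linear_combination -hc
    · simp only [ySub, QuadraticAlgebra.im_add, QuadraticAlgebra.im_mul,
        QuadraticAlgebra.algebraMap_re, QuadraticAlgebra.algebraMap_im]
      ring

theorem mumfordIdeal_ne_bot {a b : k[X]} : C.mumfordIdeal a b ≠ ⊥ := by
  intro h
  have : C.ySub b ∈ C.mumfordIdeal a b := Ideal.subset_span (by simp)
  rw [h, Ideal.mem_bot] at this
  simpa [ySub] using congrArg QuadraticAlgebra.im this

theorem mumfordIdeal_congr {a b b' : k[X]} (h : a ∣ b - b') :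
    C.mumfordIdeal a b = C.mumfordIdeal a b' := by
  obtain ⟨c, hc⟩ := h
  have : C.ySub b = C.ySub b' + -algebraMap _ _ c * algebraMap k[X] C.CoordinateRing a := by
    refine QuadraticAlgebra.ext ?_ ?_ <;> simp [ySub]
    linear_combination -hc
  rw [mumfordIdeal, mumfordIdeal, this, Ideal.span_pair_add_mul_left]

theorem map_star_mumfordIdeal (a b : k[X]) :
    (C.mumfordIdeal a b).map (starRingEnd C.CoordinateRing) = C.mumfordIdeal a (-b) := by
  have h1 : starRingEnd C.CoordinateRing (algebraMap k[X] C.CoordinateRing a) =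
      algebraMap k[X] C.CoordinateRing a := by
    rw [starRingEnd_apply]
    refine QuadraticAlgebra.ext ?_ ?_ <;> simp
  have h2 : starRingEnd C.CoordinateRing (C.ySub b) = -C.ySub (-b) := by
    rw [starRingEnd_apply]
    refine QuadraticAlgebra.ext ?_ ?_ <;> simp [ySub]
  rw [mumfordIdeal, Ideal.map_span, Set.image_pair, h1, h2, mumfordIdeal, Ideal.span_insert,
    Ideal.span_singleton_neg, ← Ideal.span_insert]

/-- Polynomials without a common factor whose square divides `f` generate the unit ideal. -/
theorem exists_combination_eq_one (p q r : k[X])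
    (h : ∀ e, e ∣ p → e ∣ q → e ∣ r → e * e ∣ C.f) :
    ∃ x y z : k[X], x * p + y * q + z * r = 1 := by
  obtain ⟨e, he⟩ := IsPrincipalIdealRing.principal (Ideal.span {p, q, r})
  have hmem : ∀ t ∈ ({p, q, r} : Set k[X]), e ∣ t := fun t ht => by
    have := Ideal.subset_span (α := k[X]) ht
    rw [he] at this
    exact Ideal.mem_span_singleton.mp this
  have hu : IsUnit e := C.squarefree e (h e (hmem p (by simp)) (hmem q (by simp))
    (hmem r (by simp)))
  have h1 : (1 : k[X]) ∈ Ideal.span {p, q, r} := by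
    rw [he]
    exact Ideal.mem_span_singleton.mpr hu.dvd
  rw [Ideal.mem_span_insert] at h1
  obtain ⟨x, t, ht, h1⟩ := h1
  obtain ⟨y, z, rfl⟩ := Ideal.mem_span_pair.mp ht
  exact ⟨x, y, z, by rw [h1]; ring⟩

theorem ySub_mul_ySub (b : k[X]) : C.ySub b * C.ySub b =
    algebraMap k[X] _ (C.f - b ^ 2) - algebraMap k[X] _ (2 * b) * C.ySub b := by
  refine QuadraticAlgebra.ext ?_ ?_ <;> simp [ySub, pow_two] <;> ring

theorem ySub_mul_ySub_neg (b : k[X]) : C.ySub b * C.ySub (-b) =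
    algebraMap k[X] _ (C.f - b ^ 2) := by
  refine QuadraticAlgebra.ext ?_ ?_ <;> simp [ySub, pow_two]
  ring

/-- The factors need not be coprime; squares of ideals are needed later. A common divisor e of a,
a', 2b has e² ∣ f, so these three generate 1, and y - b is recovered from a (y - b), a' (y - b) and
(y - b)² = a a' c - 2b (y - b). -/
theorem mumfordIdeal_mul {a a' b : k[X]} (h : a * a' ∣ C.f - b ^ 2) :
    C.mumfordIdeal a b * C.mumfordIdeal a' b = C.mumfordIdeal (a * a') b := by
  obtain ⟨x, y, z, hxyz⟩ := C.exists_combination_eq_one a a' (2 * b) fun e h1 h2 h3 => by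
    have h3 : e ∣ b := (C.isUnit_two.dvd_mul_left).mp h3
    have := dvd_add ((mul_dvd_mul h1 h2).trans h) (mul_dvd_mul h3 h3)
    rwa [← pow_two b, sub_add_cancel] at this
  obtain ⟨c, hc⟩ := h
  let A := algebraMap k[X] C.CoordinateRing
  have hY := C.ySub_mul_ySub b
  rw [hc] at hY
  rw [mumfordIdeal, mumfordIdeal, mumfordIdeal, Ideal.span_pair_mul_span_pair]
  apply le_antisymm
  · rw [Ideal.span_le]
    rintro t (rfl | rfl | rfl | rfl) <;> rw [SetLike.mem_coe, Ideal.mem_span_pair]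
    · exact ⟨1, 0, by simp⟩
    · exact ⟨0, A a, by simp [A]⟩
    · exact ⟨0, A a', by simp [A, mul_comm]⟩
    · exact ⟨A c, -A (2 * b), by rw [hY]; simp only [A, map_mul]; ring⟩
  · rw [Ideal.span_le]
    set J := Ideal.span {A a * A a', A a * C.ySub b, C.ySub b * A a', C.ySub b * C.ySub b}
    have h1 : A a * A a' ∈ J := Ideal.subset_span (by simp)
    have h2 : A a * C.ySub b ∈ J := Ideal.subset_span (by simp)
    have h3 : C.ySub b * A a' ∈ J := Ideal.subset_span (by simp)
    have h4 : C.ySub b * C.ySub b ∈ J := Ideal.subset_span (by simp)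
    rintro t (rfl | rfl) <;> rw [SetLike.mem_coe]
    · rw [map_mul]
      exact h1
    · have : C.ySub b = A x * (A a * C.ySub b) + A y * (C.ySub b * A a')
          + A z * (A c * (A a * A a') - C.ySub b * C.ySub b) := by
        have h5 := congrArg A hxyz
        simp only [map_add, map_mul, map_one] at h5
        rw [hY]
        simp only [A, map_mul] at h5 ⊢
        linear_combination -C.ySub b * h5
      rw [this]
      exact J.add_mem (J.add_mem (J.mul_mem_left _ h2) (J.mul_mem_left _ h3))
        (J.mul_mem_left _ (J.sub_mem (J.mul_mem_left _ h1) h4))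

/-- With f - b² = a c, a common divisor of a, c, 2b has its square dividing f. So a, c, 2b generate
1, and a is a combination of a², (y - b)(y + b) = a c and a (y + b) - a (y - b) = 2ab. -/
theorem mumfordIdeal_mul_neg {a b : k[X]} (h : a ∣ C.f - b ^ 2) :
    C.mumfordIdeal a b * C.mumfordIdeal a (-b) = Ideal.span {algebraMap k[X] _ a} := by
  obtain ⟨c, hc⟩ := h
  obtain ⟨x, y, z, hxyz⟩ := C.exists_combination_eq_one a c (2 * b) fun e h1 h2 h3 => by
    have h3 : e ∣ b := (C.isUnit_two.dvd_mul_left).mp h3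
    have := dvd_add (mul_dvd_mul h1 h2) (mul_dvd_mul h3 h3)
    rwa [← hc, ← pow_two b, sub_add_cancel] at this
  let A := algebraMap k[X] C.CoordinateRing
  have hY := C.ySub_mul_ySub_neg b
  rw [hc] at hY
  have hY' : C.ySub (-b) = C.ySub b + A (2 * b) := by
    refine QuadraticAlgebra.ext ?_ ?_ <;> simp [ySub, A]
    ring
  rw [mumfordIdeal, mumfordIdeal, Ideal.span_pair_mul_span_pair]
  apply le_antisymm
  · rw [Ideal.span_le]
    rintro t (rfl | rfl | rfl | rfl) <;> rw [SetLike.mem_coe, Ideal.mem_span_singleton]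
    · exact dvd_mul_right _ _
    · exact dvd_mul_right _ _
    · exact dvd_mul_left _ _
    · rw [hY, map_mul]
      exact dvd_mul_right _ _
  · rw [Ideal.span_singleton_le_iff_mem]
    set J := Ideal.span {A a * A a, A a * C.ySub (-b), C.ySub b * A a, C.ySub b * C.ySub (-b)}
    have h1 : A a * A a ∈ J := Ideal.subset_span (by simp)
    have h2 : A a * C.ySub (-b) ∈ J := Ideal.subset_span (by simp)
    have h3 : C.ySub b * A a ∈ J := Ideal.subset_span (by simp)
    have h4 : C.ySub b * C.ySub (-b) ∈ J := Ideal.subset_span (by simp)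
    have : A a = A x * (A a * A a) + A y * (C.ySub b * C.ySub (-b))
        + A z * (A a * C.ySub (-b) - C.ySub b * A a) := by
      have h5 := congrArg A hxyz
      simp only [map_add, map_mul, map_one] at h5
      rw [hY, hY']
      simp only [A, map_mul] at h5 ⊢
      linear_combination -algebraMap k[X] C.CoordinateRing a * h5
    change A a ∈ J
    rw [this]
    exact J.add_mem (J.add_mem (J.mul_mem_left _ h1) (J.mul_mem_left _ h4))
      (J.mul_mem_left _ (J.sub_mem h2 h3))

/-- The principal ideal of `V(x) - U(x) * y` is a Mumford ideal if `U` is coprime to the norm. -/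
theorem span_singleton_eq_mumfordIdeal {γ U V N t : k[X]} (hγ : IsUnit γ)
    (hN : γ * N = V ^ 2 - U ^ 2 * C.f) (hU : IsCoprime U N) (ht : N ∣ V - U * t) :
    N ∣ C.f - t ^ 2 ∧
      Ideal.span {(⟨V, -U⟩ : C.CoordinateRing)} = C.mumfordIdeal N t := by
  have hNt : N ∣ C.f - t ^ 2 := by
    refine (hU.symm.pow_right (n := 2)).dvd_of_dvd_mul_left ?_
    have h1 : U ^ 2 * (C.f - t ^ 2) = (V - U * t) * (V + U * t) - γ * N := by rw [hN]; ring
    rw [h1]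
    exact dvd_sub (ht.mul_right _) (dvd_mul_left _ _)
  refine ⟨hNt, le_antisymm ?_ ?_⟩
  · rw [Ideal.span_singleton_le_iff_mem, C.mem_mumfordIdeal hNt]
    simpa [sub_eq_add_neg] using ht
  · obtain ⟨δ, hδ⟩ := hγ.exists_right_inv
    obtain ⟨x, y, hxy⟩ := hU
    obtain ⟨z, hz⟩ := ht
    have hNmem : algebraMap k[X] C.CoordinateRing N ∈
        Ideal.span {(⟨V, -U⟩ : C.CoordinateRing)} := by
      rw [Ideal.mem_span_singleton]
      refine ⟨⟨δ * V, δ * U⟩, QuadraticAlgebra.ext ?_ ?_⟩ <;> simp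
      · linear_combination δ * hN - N * hδ
      · ring
    rw [mumfordIdeal, Ideal.span_le]
    rintro s (rfl | rfl)
    · exact hNmem
    -- Modulo N the polynomial x is inverse to U, and multiplication by -x turns V - U y into y - t.
    · have : C.ySub t = -algebraMap k[X] C.CoordinateRing x * ⟨V, -U⟩ +
          algebraMap k[X] C.CoordinateRing N * ⟨x * z - y * t, y⟩ := by
        refine QuadraticAlgebra.ext ?_ ?_ <;> simp [ySub]
        · linear_combination t * hxy + x * hz
        · linear_combination -hxy
      rw [SetLike.mem_coe, this]
      exact Ideal.add_mem _ (Ideal.mul_mem_left _ _ (Ideal.mem_span_singleton_self _))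
        (Ideal.mul_mem_right _ _ hNmem)

/-- In the norm p² - f q² the first term has even degree and the second, if nonzero, odd degree at
least 2g + 1, so they cannot cancel. -/
theorem im_eq_zero_of_natDegree_norm_le {z : C.CoordinateRing}
    (h : z.norm.natDegree ≤ 2 * C.g) : z.im = 0 := by
  by_contra hi
  have hn : z.norm = z.re ^ 2 - C.f * z.im ^ 2 := by
    rw [QuadraticAlgebra.norm_def]; ring
  have h1 : (z.re ^ 2).natDegree = 2 * z.re.natDegree := natDegree_pow _ _
  have h2 : (C.f * z.im ^ 2).natDegree = 2 * C.g + 1 + 2 * z.im.natDegree := by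
    rw [natDegree_mul C.f_ne_zero (pow_ne_zero 2 hi), natDegree_pow, C.natDegree_eq]
  rcases lt_or_ge (z.re ^ 2).natDegree (C.f * z.im ^ 2).natDegree with hlt | hge
  · rw [hn, natDegree_sub_eq_right_of_natDegree_lt hlt] at h
    omega
  · rw [hn, natDegree_sub_eq_left_of_natDegree_lt (by omega)] at h
    omega

theorem exists_eq_algebraMap_C_of_isUnit {z : C.CoordinateRing} (hz : IsUnit z) :
    ∃ c : k, z = algebraMap k[X] _ (Polynomial.C c) := by
  have hn := natDegree_eq_zero_of_isUnit (hz.map QuadraticAlgebra.norm)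
  have him := C.im_eq_zero_of_natDegree_norm_le (hn.le.trans (Nat.zero_le _))
  have h1 : z = algebraMap k[X] _ z.re := QuadraticAlgebra.ext rfl him
  rw [h1, QuadraticAlgebra.norm_algebraMap, natDegree_pow] at hn
  refine ⟨z.re.coeff 0, ?_⟩
  rw [← eq_C_of_natDegree_eq_zero (by simpa using hn), ← h1]

theorem eq_and_dvd_of_mumfordIdeal_eq {w r w' r' : k[X]} (hw : w.Monic) (hw' : w'.Monic)
    (h : w ∣ C.f - r ^ 2) (h' : w' ∣ C.f - r' ^ 2)
    (heq : C.mumfordIdeal w r = C.mumfordIdeal w' r') : w = w' ∧ w ∣ r - r' := by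
  have h1 : algebraMap k[X] _ w ∈ C.mumfordIdeal w' r' := heq ▸ Ideal.subset_span (by simp)
  have h2 : algebraMap k[X] _ w' ∈ C.mumfordIdeal w r := heq ▸ Ideal.subset_span (by simp)
  have h3 : C.ySub r' ∈ C.mumfordIdeal w r := heq ▸ Ideal.subset_span (by simp)
  rw [C.mem_mumfordIdeal h'] at h1
  rw [C.mem_mumfordIdeal h] at h2 h3
  simp only [QuadraticAlgebra.algebraMap_re, QuadraticAlgebra.algebraMap_im, zero_mul,
    add_zero] at h1 h2
  refine ⟨eq_of_monic_of_associated hw hw' (associated_of_dvd_dvd h2 h1), ?_⟩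
  convert h3 using 1
  simp [ySub]
  ring

/-- Reduced Mumford representations with the same class in `J(k)` define the same ideal. -/
theorem mumfordIdeal_eq_of_mumfordPoint_eq {w r w' r' : k[X]} (hw : w.Monic) (hw' : w'.Monic)
    (h : w ∣ C.f - r ^ 2) (h' : w' ∣ C.f - r' ^ 2) (hg : w.natDegree ≤ C.g)
    (hg' : w'.natDegree ≤ C.g) (heq : C.mumfordPoint w r = C.mumfordPoint w' r') :
    C.mumfordIdeal w r = C.mumfordIdeal w' r' := by
  let A := algebraMap k[X] C.CoordinateRing
  have hA : ∀ p q, Ideal.span {A p} = Ideal.span {A q} → p ∣ q := fun p q hpq => by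
    have : A q ∈ Ideal.span {A p} := hpq ▸ Ideal.mem_span_singleton_self _
    rw [Ideal.mem_span_singleton] at this
    exact QuadraticAlgebra.algebraMap_dvd_iff_dvd.mp this
  have hAw' : A w' ≠ 0 := by
    simpa [A] using hw'.ne_zero
  obtain ⟨h₁, h₂, hh₁, hh₂, e⟩ := C.exists_span_mul_eq_of_toJacobian_eq
    C.mumfordIdeal_ne_bot C.mumfordIdeal_ne_bot heq
  -- The conjugate ideal (w',-r') inverts the class of (w',r'), so its product with (w,r) is
  -- principal.
  have e' : C.mumfordIdeal w r * C.mumfordIdeal w' (-r') * Ideal.span {h₂} =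
      Ideal.span {A w' * h₁} := by
    rw [mul_right_comm, e, mul_right_comm, C.mumfordIdeal_mul_neg h',
      Ideal.span_singleton_mul_span_singleton]
  obtain ⟨h, hh⟩ : h₂ ∣ A w' * h₁ := by
    rw [← Ideal.span_singleton_le_span_singleton, ← e']
    exact Ideal.mul_le_right
  have e'' : C.mumfordIdeal w r * C.mumfordIdeal w' (-r') = Ideal.span {h} := by
    refine mul_right_cancel₀ (b := Ideal.span {h₂}) (by simpa using hh₂) ?_
    rw [e', hh, Ideal.span_singleton_mul_span_singleton, mul_comm]
  have hnorm : Ideal.span {A (w * w')} = Ideal.span {A h.norm} := by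
    have e3 := congrArg (Ideal.map (starRingEnd C.CoordinateRing)) e''
    rw [Ideal.map_mul, map_star_mumfordIdeal, map_star_mumfordIdeal, neg_neg, Ideal.map_span,
      Set.image_singleton, starRingEnd_apply] at e3
    have e4 := congrArg₂ (· * ·) e'' e3
    rw [mul_mul_mul_comm, C.mumfordIdeal_mul_neg ‹_›, mul_comm (C.mumfordIdeal w' (-r')),
      C.mumfordIdeal_mul_neg h', Ideal.span_singleton_mul_span_singleton,
      Ideal.span_singleton_mul_span_singleton, ← map_mul] at e4
    rw [e4]
    simp only [A]
    rw [QuadraticAlgebra.algebraMap_norm_eq_mul_star]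
  -- The norm of the generator is w w' up to a unit, hence has degree at most 2g; the generator is a
  -- polynomial in x.
  have him : h.im = 0 := by
    refine C.im_eq_zero_of_natDegree_norm_le ?_
    have := natDegree_le_of_dvd (hA _ _ hnorm.symm) (hw.mul hw').ne_zero
    rw [natDegree_mul hw.ne_zero hw'.ne_zero] at this
    omega
  have hhA : h = A h.re := QuadraticAlgebra.ext rfl him
  rw [hhA] at e''
  have e5 : C.mumfordIdeal w r * Ideal.span {A w'} =
      C.mumfordIdeal w' r' * Ideal.span {A h.re} := by
    rw [← C.mumfordIdeal_mul_neg h', mul_left_comm, e'']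
  -- The coefficient of y in (y - q) u is u, so v divides u if this element lies in (v).
  have key : ∀ {p q u v p' q' : k[X]}, C.mumfordIdeal p q * Ideal.span {A u} =
      C.mumfordIdeal p' q' * Ideal.span {A v} → v ∣ u := fun {p q u v p' q'} he => by
    have h1 : C.ySub q * A u ∈ C.mumfordIdeal p q * Ideal.span {A u} :=
      Ideal.mul_mem_mul (Ideal.subset_span (by simp)) (Ideal.mem_span_singleton_self _)
    rw [he] at h1
    have h2 := Ideal.mem_span_singleton.mp (Ideal.mul_le_right h1)
    rw [QuadraticAlgebra.algebraMap_dvd_iff] at h2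
    simpa [ySub, A] using h2.2
  have h6 : Ideal.span {A h.re} = Ideal.span {A w'} := by
    rw [Ideal.span_singleton_eq_span_singleton]
    exact associated_of_dvd_dvd (map_dvd A (key e5)) (map_dvd A (key e5.symm))
  rw [h6] at e5
  exact mul_right_cancel₀ (by simpa using hAw') e5

end OddHyperellipticCurve

/-! ### Monic gcds and divisibility for squarefree moduli. -/

section MonicGcd

variable {k : Type*} [Field k]

theorem monicGcd_dvd_left (p q : k[X]) : monicGcd p q ∣ p := by
  classical
  exact normalize_dvd_iff.mpr (EuclideanDomain.gcd_dvd_left p q)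

theorem monicGcd_dvd_right (p q : k[X]) : monicGcd p q ∣ q := by
  classical
  exact normalize_dvd_iff.mpr (EuclideanDomain.gcd_dvd_right p q)

theorem exists_monicGcd_eq (p q : k[X]) : ∃ x y, monicGcd p q = x * p + y * q := by
  classical
  have h : EuclideanDomain.gcd p q ∣ monicGcd p q := dvd_normalize_iff.mpr dvd_rfl
  obtain ⟨c, hc⟩ := h
  refine ⟨c * EuclideanDomain.gcdA p q, c * EuclideanDomain.gcdB p q, ?_⟩
  rw [hc, EuclideanDomain.gcd_eq_gcd_ab]
  ring

theorem monic_monicGcd {p q : k[X]} (h : q ≠ 0) : (monicGcd p q).Monic := by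
  classical
  refine monic_normalize fun h0 => h ?_
  exact (EuclideanDomain.gcd_eq_zero_iff.mp h0).2

theorem isCoprime_of_eq_monicGcd_mul {p q p' q' : k[X]} (hq : q ≠ 0)
    (hp' : p = monicGcd p q * p') (hq' : q = monicGcd p q * q') : IsCoprime p' q' := by
  obtain ⟨x, y, h⟩ := exists_monicGcd_eq p q
  refine ⟨x, y, mul_left_cancel₀ (monic_monicGcd (p := p) hq).ne_zero ?_⟩
  linear_combination -h - x * hp' - y * hq'

theorem isCoprime_of_monicGcd_eq_one {p q : k[X]} (h : monicGcd p q = 1) : IsCoprime p q := by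
  obtain ⟨x, y, hxy⟩ := exists_monicGcd_eq p q
  exact ⟨x, y, by rw [← hxy, h]⟩

/-- If `m` divides `p * t`, then it divides `gcd (p, n) * t` for each multiple `n` of `m`. -/
theorem dvd_monicGcd_mul {m n p t : k[X]} (hn : m ∣ n) (h : m ∣ p * t) :
    m ∣ monicGcd p n * t := by
  obtain ⟨x, y, h'⟩ := exists_monicGcd_eq p n
  rw [h', show (x * p + y * n) * t = x * (p * t) + n * (y * t) by ring]
  exact dvd_add (h.mul_left _) (hn.mul_right _)

theorem eq_monicGcd_mul_monicGcd {p q r : k[X]} (hp : p.Monic) (hq : q ≠ 0) (hr : r ≠ 0)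
    (hqr : IsCoprime q r) (h : p ∣ q * r) : p = monicGcd p q * monicGcd p r := by
  refine eq_of_monic_of_associated hp ((monic_monicGcd hq).mul (monic_monicGcd hr))
    (associated_of_dvd_dvd ?_ ?_)
  · obtain ⟨x, y, h1⟩ := exists_monicGcd_eq p q
    obtain ⟨x', y', h2⟩ := exists_monicGcd_eq p r
    rw [h1, h2, show (x * p + y * q) * (x' * p + y' * r) =
      p * (x * (x' * p + y' * r) + y * q * x') + q * r * (y * y') by ring]
    exact dvd_add (dvd_mul_right _ _) (h.mul_right _)
  · exact (hqr.of_isCoprime_of_dvd_left (monicGcd_dvd_right p q)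
      |>.of_isCoprime_of_dvd_right (monicGcd_dvd_right p r)).mul_dvd
      (monicGcd_dvd_left p q) (monicGcd_dvd_left p r)

theorem Squarefree.isCoprime_of_mul {p q : k[X]} (h : Squarefree (p * q)) : IsCoprime p q := by
  rw [squarefree_mul_iff] at h
  exact h.1.isCoprime

/-- Split m into gcd(G,m) and its cofactor. These are coprime because m is squarefree; G can be
cancelled modulo the cofactor, and the last hypothesis covers gcd(G,m). -/
theorem dvd_of_dvd_monicGcd_mul {m G w T : k[X]} (hm : Squarefree m) (hw : IsCoprime w m)
    (h : m ∣ G * (w * T)) (h' : monicGcd G m ∣ w * T) : m ∣ T := by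
  refine hw.symm.dvd_of_dvd_mul_left ?_
  have h1 := dvd_monicGcd_mul dvd_rfl h
  obtain ⟨m', hm'⟩ := monicGcd_dvd_right G m
  have hcop : IsCoprime (monicGcd G m) m' := Squarefree.isCoprime_of_mul (hm' ▸ hm)
  have h2 : m' ∣ w * T := hcop.symm.dvd_of_dvd_mul_left ((Dvd.intro_left _ hm'.symm).trans h1)
  have := hcop.mul_dvd h' h2
  rwa [← hm'] at this

end MonicGcd

/-! ### The halving datum and the relation (ii). -/

namespace OddHyperellipticCurve

variable {k : Type*} [Field k] (C : OddHyperellipticCurve k)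

/-- The hypotheses on `a`, `b` and `s`, with `d = gcd (a, f)`, `a = d * a₁` and `f = d * f₁`. -/
structure IsHalvingDatum (a b d a₁ f₁ s : k[X]) : Prop where
  monic : a.Monic
  squarefree : Squarefree a
  natDegree_le : a.natDegree ≤ 2 * C.g + 1
  eq_a : a = d * a₁
  eq_f : C.f = d * f₁
  isCoprime_a₁_f₁ : IsCoprime a₁ f₁
  dvd : a ∣ C.f - b ^ 2
  isSqrt : C.IsSqrt a a₁ f₁ s

variable {C} {a b d a₁ f₁ s : k[X]}

theorem isUnit_C_neg_leadingCoeff_pow (C : OddHyperellipticCurve k) (n : ℕ) :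
    IsUnit (Polynomial.C ((-C.f.leadingCoeff) ^ n)) := by
  rw [isUnit_C, isUnit_iff_ne_zero]
  exact pow_ne_zero _ (neg_ne_zero.mpr (leadingCoeff_ne_zero.mpr C.f_ne_zero))

namespace IsHalvingDatum

theorem of_monicGcd (ha : a.Monic) (ha' : Squarefree a)
    (hdeg : a.natDegree ≤ 2 * C.g + 1) (hd : d = monicGcd a C.f) (had : a = d * a₁)
    (hfd : C.f = d * f₁) (hb : a ∣ C.f - b ^ 2) (hs : C.IsSqrt a a₁ f₁ s) :
    C.IsHalvingDatum a b d a₁ f₁ s where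
  monic := ha
  squarefree := ha'
  natDegree_le := hdeg
  eq_a := had
  eq_f := hfd
  isCoprime_a₁_f₁ := isCoprime_of_eq_monicGcd_mul C.f_ne_zero (by rw [← hd, ← had])
    (by rw [← hd, ← hfd])
  dvd := hb
  isSqrt := hs

theorem isCoprime_d_a₁ (h : C.IsHalvingDatum a b d a₁ f₁ s) : IsCoprime d a₁ :=
  Squarefree.isCoprime_of_mul (h.eq_a ▸ h.squarefree)

theorem isCoprime_d_f₁ (h : C.IsHalvingDatum a b d a₁ f₁ s) : IsCoprime d f₁ :=
  Squarefree.isCoprime_of_mul (h.eq_f ▸ C.squarefree)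

theorem isCoprime_f_a₁ (h : C.IsHalvingDatum a b d a₁ f₁ s) : IsCoprime C.f a₁ := by
  rw [h.eq_f]
  exact h.isCoprime_d_a₁.mul_left h.isCoprime_a₁_f₁.symm

theorem squarefree_d (h : C.IsHalvingDatum a b d a₁ f₁ s) : Squarefree d :=
  C.squarefree.squarefree_of_dvd (Dvd.intro _ h.eq_f.symm)

theorem squarefree_f₁ (h : C.IsHalvingDatum a b d a₁ f₁ s) : Squarefree f₁ :=
  C.squarefree.squarefree_of_dvd (Dvd.intro_left _ h.eq_f.symm)

theorem squarefree_a₁ (h : C.IsHalvingDatum a b d a₁ f₁ s) : Squarefree a₁ :=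
  h.squarefree.squarefree_of_dvd (Dvd.intro_left _ h.eq_a.symm)

theorem natDegree_a (h : C.IsHalvingDatum a b d a₁ f₁ s) :
    a.natDegree = d.natDegree + a₁.natDegree := by
  rw [h.eq_a, natDegree_mul h.squarefree_d.ne_zero h.squarefree_a₁.ne_zero]

theorem natDegree_f (h : C.IsHalvingDatum a b d a₁ f₁ s) :
    d.natDegree + f₁.natDegree = 2 * C.g + 1 := by
  rw [← C.natDegree_eq, h.eq_f, natDegree_mul h.squarefree_d.ne_zero h.squarefree_f₁.ne_zero]

theorem d_dvd_b (h : C.IsHalvingDatum a b d a₁ f₁ s) : d ∣ b := by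
  have h1 : d ∣ C.f - b ^ 2 := (Dvd.intro _ h.eq_a.symm).trans h.dvd
  have h2 : d ∣ b ^ 2 := (dvd_sub_right (Dvd.intro _ h.eq_f.symm)).mp h1
  exact h.squarefree_d.isRadical 2 b h2

theorem a₁_dvd (h : C.IsHalvingDatum a b d a₁ f₁ s) : a₁ ∣ C.f - b ^ 2 :=
  (Dvd.intro_left _ h.eq_a.symm).trans h.dvd

theorem f₁_dvd (h : C.IsHalvingDatum a b d a₁ f₁ s) :
    f₁ ∣ Polynomial.C ((-C.f.leadingCoeff) ^ a.natDegree) * (d * a₁) - s ^ 2 := by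
  have h1 := (Dvd.intro_left _ h.eq_f.symm).trans h.isSqrt
  have h2 : f₁ ∣ Polynomial.C ((-C.f.leadingCoeff) ^ a.natDegree) * (a₁ * f₁) :=
    (dvd_mul_left _ _).mul_left _
  convert dvd_add h1 h2 using 1
  rw [← h.eq_a]
  ring

theorem d_dvd (h : C.IsHalvingDatum a b d a₁ f₁ s) :
    d ∣ Polynomial.C ((-C.f.leadingCoeff) ^ a.natDegree) * (a₁ * f₁) + s ^ 2 := by
  have h1 := (Dvd.intro _ h.eq_f.symm).trans h.isSqrt
  have h2 : d ∣ Polynomial.C ((-C.f.leadingCoeff) ^ a.natDegree) * a :=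
    (Dvd.intro _ h.eq_a.symm).mul_left _
  convert dvd_sub h2 h1 using 1
  ring

/-- The difference of the two sides is divisible by d, a₁ and f₁, hence by their product of degree
2g + 1 + deg a₁, while each term has degree at most 2g + deg a₁. That w is monic is not assumed, so
that the case w = 0 can be excluded in the existence proof. -/
theorem relation (h : C.IsHalvingDatum a b d a₁ f₁ s) {u v w : k[X]}
    (h1 : f₁ ∣ v * d - w * s) (h2 : a₁ ∣ v * d - u * b) (h3 : d ∣ u * f₁ - w * s)
    (hu : u ≠ 0 → 2 * u.natDegree < a.natDegree)
    (hv : v ≠ 0 → 2 * v.natDegree + 2 * d.natDegree ≤ 2 * C.g + a.natDegree)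
    (hw : w.natDegree ≤ C.g) :
    u ^ 2 * f₁ = d * v ^ 2 -
      Polynomial.C ((-C.f.leadingCoeff) ^ a.natDegree) * a₁ * w ^ 2 := by
  have hf₁ := h.f₁_dvd
  have hd := h.d_dvd
  have hγ := natDegree_C ((-C.f.leadingCoeff) ^ a.natDegree)
  set γ := Polynomial.C ((-C.f.leadingCoeff) ^ a.natDegree)
  have e1 : f₁ ∣ u ^ 2 * f₁ - (d * v ^ 2 - γ * a₁ * w ^ 2) := by
    refine h.isCoprime_d_f₁.symm.dvd_of_dvd_mul_left (y := d) ?_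
    rw [show d * (u ^ 2 * f₁ - (d * v ^ 2 - γ * a₁ * w ^ 2)) = f₁ * (d * u ^ 2) -
      (v * d - w * s) * (v * d + w * s) + (γ * (d * a₁) - s ^ 2) * w ^ 2 by ring]
    exact dvd_add (dvd_sub (dvd_mul_right _ _) (h1.mul_right _)) (hf₁.mul_right _)
  have e2 : a₁ ∣ u ^ 2 * f₁ - (d * v ^ 2 - γ * a₁ * w ^ 2) := by
    refine h.isCoprime_d_a₁.symm.dvd_of_dvd_mul_left (y := d) ?_
    rw [show d * (u ^ 2 * f₁ - (d * v ^ 2 - γ * a₁ * w ^ 2)) = (C.f - b ^ 2) * u ^ 2 -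
      (v * d - u * b) * (v * d + u * b) + a₁ * (γ * d * w ^ 2) by rw [h.eq_f]; ring]
    exact dvd_add (dvd_sub (h.a₁_dvd.mul_right _) (h2.mul_right _)) (dvd_mul_right _ _)
  have e3 : d ∣ u ^ 2 * f₁ - (d * v ^ 2 - γ * a₁ * w ^ 2) := by
    refine h.isCoprime_d_f₁.dvd_of_dvd_mul_left (y := f₁) ?_
    rw [show f₁ * (u ^ 2 * f₁ - (d * v ^ 2 - γ * a₁ * w ^ 2)) =
      (u * f₁ - w * s) * (u * f₁ + w * s) - d * (v ^ 2 * f₁) + (γ * (a₁ * f₁) + s ^ 2) * w ^ 2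
      by ring]
    exact dvd_add (dvd_sub (h3.mul_right _) (dvd_mul_right _ _)) (hd.mul_right _)
  have e4 := (h.isCoprime_d_f₁.mul_left h.isCoprime_a₁_f₁).mul_dvd
    (h.isCoprime_d_a₁.mul_dvd e3 e2) e1
  have hda := h.natDegree_a
  have hdf := h.natDegree_f
  have hdeg : (d * a₁ * f₁).natDegree = 2 * C.g + 1 + a₁.natDegree := by
    rw [natDegree_mul (mul_ne_zero h.squarefree_d.ne_zero h.squarefree_a₁.ne_zero)
      h.squarefree_f₁.ne_zero, natDegree_mul h.squarefree_d.ne_zero h.squarefree_a₁.ne_zero]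
    omega
  rw [← sub_eq_zero]
  refine eq_zero_of_dvd_of_natDegree_lt e4
    (lt_of_le_of_lt (b := 2 * C.g + a₁.natDegree) ?_ (by omega))
  have d1 : (u ^ 2 * f₁).natDegree ≤ 2 * C.g + a₁.natDegree := by
    by_cases hu0 : u = 0
    · simp [hu0]
    · have := hu hu0
      have := natDegree_mul_le (p := u ^ 2) (q := f₁)
      rw [natDegree_pow] at this
      omega
  have d2 : (d * v ^ 2).natDegree ≤ 2 * C.g + a₁.natDegree := by
    by_cases hv0 : v = 0
    · simp [hv0]
    · have := hv hv0
      have := natDegree_mul_le (p := d) (q := v ^ 2)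
      rw [natDegree_pow] at this
      omega
  have d3 : (γ * a₁ * w ^ 2).natDegree ≤ 2 * C.g + a₁.natDegree := by
    have h4 := natDegree_mul_le (p := γ * a₁) (q := w ^ 2)
    have h5 := natDegree_mul_le (p := γ) (q := a₁)
    rw [natDegree_pow] at h4
    omega
  simpa using natDegree_sub_le_of_le d1 (natDegree_sub_le_of_le d2 d3)

end IsHalvingDatum

end OddHyperellipticCurve

/-! ### Existence of solutions and of minimal solutions. -/

namespace OddHyperellipticCurve

variable {k : Type*} [Field k] {C : OddHyperellipticCurve k} {a b d a₁ f₁ s : k[X]}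

theorem natDegree_lt_of_mem_degreeLT {n : ℕ} {p : k[X]} (hp : p ∈ degreeLT k n) (h : p ≠ 0) :
    p.natDegree < n := by
  rw [mem_degreeLT] at hp
  exact (natDegree_lt_iff_degree_lt h).mpr hp

theorem finrank_degreeLT (n : ℕ) : Module.finrank k (degreeLT k n) = n := by
  rw [(degreeLTEquiv k n).finrank_eq, Module.finrank_fin_fun]

theorem finite_degreeLT (n : ℕ) : Module.Finite k (degreeLT k n) :=
  Module.Finite.equiv (degreeLTEquiv k n).symm

namespace IsHalvingDatum

theorem exists_isSolution (h : C.IsHalvingDatum a b d a₁ f₁ s) :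
    ∃ u v w : k[X], C.IsSolution a b d a₁ f₁ s u v w := by
  have hda := h.natDegree_a
  have hdf := h.natDegree_f
  have hle := h.natDegree_le
  have hf₁ := h.squarefree_f₁.ne_zero
  have ha₁ := h.squarefree_a₁.ne_zero
  have hd := h.squarefree_d.ne_zero
  -- The three factors count the coefficients of u, v, w. The two halves of deg a are rounded up and
  -- down, so the total is 2g + 2 + deg a - deg d = 2g + 2 + deg a₁, one more than deg f₁ + deg a₁ +
  -- deg d. The natural subtraction does not truncate, because deg d ≤ deg a ≤ 2g + 1.
  let M := degreeLT k ((a.natDegree + 1) / 2) ×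
    degreeLT k (C.g + a.natDegree / 2 + 1 - d.natDegree) × degreeLT k (C.g + 1)
  let pu : M →ₗ[k] k[X] := (Submodule.subtype _).comp (LinearMap.fst _ _ _)
  let pv : M →ₗ[k] k[X] := (Submodule.subtype _).comp
    ((LinearMap.fst _ _ _).comp (LinearMap.snd _ _ _))
  let pw : M →ₗ[k] k[X] := (Submodule.subtype _).comp
    ((LinearMap.snd _ _ _).comp (LinearMap.snd _ _ _))
  let q (m : k[X]) : k[X] →ₗ[k] k[X] ⧸ Ideal.span {m} :=
    (Ideal.Quotient.mkₐ k (Ideal.span {m})).toLinearMap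
  have hq : ∀ m t, q m t = 0 → m ∣ t := fun m t ht =>
    Ideal.mem_span_singleton.mp (Ideal.Quotient.eq_zero_iff_mem.mp ht)
  let L : M →ₗ[k] (k[X] ⧸ Ideal.span {f₁}) × (k[X] ⧸ Ideal.span {a₁}) × (k[X] ⧸ Ideal.span {d}) :=
    ((q f₁).comp ((LinearMap.mulRight k d).comp pv - (LinearMap.mulRight k s).comp pw)).prod
    (((q a₁).comp ((LinearMap.mulRight k d).comp pv - (LinearMap.mulRight k b).comp pu)).prod
    ((q d).comp ((LinearMap.mulRight k f₁).comp pu - (LinearMap.mulRight k s).comp pw)))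
  have := finite_degreeLT (k := k) ((a.natDegree + 1) / 2)
  have := finite_degreeLT (k := k) (C.g + a.natDegree / 2 + 1 - d.natDegree)
  have := finite_degreeLT (k := k) (C.g + 1)
  have : Module.Finite k (k[X] ⧸ Ideal.span {f₁}) := (AdjoinRoot.powerBasis hf₁).finite
  have : Module.Finite k (k[X] ⧸ Ideal.span {a₁}) := (AdjoinRoot.powerBasis ha₁).finite
  have : Module.Finite k (k[X] ⧸ Ideal.span {d}) := (AdjoinRoot.powerBasis hd).finite
  have hker : LinearMap.ker L ≠ ⊥ := by
    refine LinearMap.ker_ne_bot_of_finrank_lt ?_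
    simp only [M, Module.finrank_prod, finrank_quotient_span_eq_natDegree, finrank_degreeLT]
    omega
  obtain ⟨x, hx, hx0⟩ := Submodule.exists_mem_ne_zero_of_ne_bot hker
  obtain ⟨⟨u, hu⟩, ⟨v, hv⟩, ⟨w, hw⟩⟩ := x
  rw [LinearMap.mem_ker] at hx
  have h1 : f₁ ∣ v * d - w * s := hq _ _ (congrArg Prod.fst hx)
  have h2 : a₁ ∣ v * d - u * b := hq _ _ (congrArg (fun t => t.2.1) hx)
  have h3 : d ∣ u * f₁ - w * s := hq _ _ (congrArg (fun t => t.2.2) hx)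
  have hu' : u ≠ 0 → 2 * u.natDegree < a.natDegree := fun h0 => by
    have := natDegree_lt_of_mem_degreeLT hu h0
    omega
  have hv' : v ≠ 0 → 2 * v.natDegree + 2 * d.natDegree ≤ 2 * C.g + a.natDegree := fun h0 => by
    have := natDegree_lt_of_mem_degreeLT hv h0
    omega
  have hw' : w.natDegree ≤ C.g := by
    by_cases h0 : w = 0
    · simp [h0]
    · have := natDegree_lt_of_mem_degreeLT hw h0
      omega
  -- If w = 0, the relation says that v d + u y has norm 0, which forces u = v = 0.
  have hw0 : w ≠ 0 := by
    rintro rfl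
    have hrel := h.relation h1 h2 h3 hu' hv' hw'
    have hnorm : (⟨v * d, u⟩ : C.CoordinateRing).norm = 0 := by
      rw [QuadraticAlgebra.norm_def]
      simp only
      rw [h.eq_f]
      linear_combination -d * hrel
    have hz : (⟨v * d, u⟩ : C.CoordinateRing) = 0 := by
      by_contra hz
      exact C.norm_ne_zero hz hnorm
    have hu0 : u = 0 := congrArg QuadraticAlgebra.im hz
    have hv0 : v * d = 0 := congrArg QuadraticAlgebra.re hz
    have hv0 : v = 0 := (mul_eq_zero.mp hv0).resolve_right hd
    subst hu0 hv0
    exact hx0 rfl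
  have hc : w.leadingCoeff⁻¹ ≠ 0 := inv_ne_zero (leadingCoeff_ne_zero.mpr hw0)
  have hdeg : ∀ p : k[X], (p * Polynomial.C w.leadingCoeff⁻¹).natDegree = p.natDegree := fun p =>
    natDegree_mul_C hc
  refine ⟨u * Polynomial.C w.leadingCoeff⁻¹, v * Polynomial.C w.leadingCoeff⁻¹,
    w * Polynomial.C w.leadingCoeff⁻¹, ?_, ?_, ?_, monic_mul_leadingCoeff_inv hw0, ?_, ?_, ?_⟩
  · convert h1.mul_right (Polynomial.C w.leadingCoeff⁻¹) using 1; ring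
  · convert h2.mul_right (Polynomial.C w.leadingCoeff⁻¹) using 1; ring
  · convert h3.mul_right (Polynomial.C w.leadingCoeff⁻¹) using 1; ring
  · rw [hdeg]
    exact fun h0 => hu' (left_ne_zero_of_mul h0)
  · rw [hdeg]
    exact fun h0 => hv' (left_ne_zero_of_mul h0)
  · rwa [hdeg]

theorem exists_isMinimalSolution (h : C.IsHalvingDatum a b d a₁ f₁ s) :
    ∃ u v w : k[X], C.IsMinimalSolution a b d a₁ f₁ s u v w := by
  classical
  have hex : ∃ n, ∃ u v w : k[X], C.IsSolution a b d a₁ f₁ s u v w ∧ w.natDegree = n := by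
    obtain ⟨u, v, w, hsol⟩ := h.exists_isSolution
    exact ⟨_, u, v, w, hsol, rfl⟩
  obtain ⟨u, v, w, hsol, hn⟩ := Nat.find_spec hex
  exact ⟨u, v, w, hsol, fun u' v' w' h' => hn ▸ Nat.find_min' hex ⟨u', v', w', h', rfl⟩⟩

end IsHalvingDatum

theorem IsSolution.relation {u v w : k[X]} (hsol : C.IsSolution a b d a₁ f₁ s u v w)
    (h : C.IsHalvingDatum a b d a₁ f₁ s) :
    u ^ 2 * f₁ = d * v ^ 2 -
      Polynomial.C ((-C.f.leadingCoeff) ^ a.natDegree) * a₁ * w ^ 2 :=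
  h.relation hsol.congr_f₁ hsol.congr_a₁ hsol.congr_d hsol.degree_u hsol.degree_v hsol.degree_w

/-- A minimal solution cannot be divided by a nonconstant polynomial. -/
theorem IsMinimalSolution.eq_one_of_eq_mul {u v w e u' v' w' : k[X]}
    (hmin : C.IsMinimalSolution a b d a₁ f₁ s u v w) (he : e.Monic) (hu : u = e * u')
    (hv : v = e * v') (hw : w = e * w') (h1 : f₁ ∣ v' * d - w' * s)
    (h2 : a₁ ∣ v' * d - u' * b) (h3 : d ∣ u' * f₁ - w' * s) : e = 1 := by
  subst hu hv hw
  obtain ⟨hsol, hmin⟩ := hmin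
  have hw' : w'.Monic := he.of_mul_monic_left hsol.monic
  have hdw := he.natDegree_mul hw'
  have := hmin u' v' w' ⟨h1, h2, h3, hw', fun h0 => by
      have := hsol.degree_u (mul_ne_zero he.ne_zero h0)
      rw [natDegree_mul he.ne_zero h0] at this
      omega, fun h0 => by
      have := hsol.degree_v (mul_ne_zero he.ne_zero h0)
      rw [natDegree_mul he.ne_zero h0] at this
      omega, by
      have := hsol.degree_w
      omega⟩
  exact he.natDegree_eq_zero.mp (by omega)

end OddHyperellipticCurve

/-! ### Consequences of minimality for G = gcd(u,w). -/

namespace OddHyperellipticCurve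

variable {k : Type*} [Field k] {C : OddHyperellipticCurve k} {a b d a₁ f₁ s : k[X]}

theorem dvd_of_dvd_mul_of_squarefree {m e t : k[X]} (hm : Squarefree m) (he : e ∣ m)
    (h : m ∣ e * t) (h' : e ∣ t) : m ∣ t := by
  obtain ⟨m', rfl⟩ := he
  have h0 : e ≠ 0 := left_ne_zero_of_mul hm.ne_zero
  exact (Squarefree.isCoprime_of_mul hm).mul_dvd h' ((mul_dvd_mul_iff_left h0).mp h)

variable (C) in
/-- `(G * u₁, G * v₁, G * w₁)` is a solution with `w` of minimal degree, and `G` is the greatest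
common divisor of `u` and `w`. -/
structure IsReducedSolution (a b d a₁ f₁ s G u₁ v₁ w₁ : k[X]) : Prop where
  datum : C.IsHalvingDatum a b d a₁ f₁ s
  minimal : C.IsMinimalSolution a b d a₁ f₁ s (G * u₁) (G * v₁) (G * w₁)
  monic : G.Monic
  isCoprime : IsCoprime u₁ w₁

theorem IsMinimalSolution.exists_isReducedSolution {u v w : k[X]}
    (hmin : C.IsMinimalSolution a b d a₁ f₁ s u v w) (h : C.IsHalvingDatum a b d a₁ f₁ s) :
    ∃ u₁ v₁ w₁, u = monicGcd u w * u₁ ∧ v = monicGcd u w * v₁ ∧ w = monicGcd u w * w₁ ∧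
      C.IsReducedSolution a b d a₁ f₁ s (monicGcd u w) u₁ v₁ w₁ := by
  have hw := hmin.isSolution.monic
  have hG : (monicGcd u w).Monic := monic_monicGcd hw.ne_zero
  obtain ⟨u₁, hu₁⟩ := monicGcd_dvd_left u w
  obtain ⟨w₁, hw₁⟩ := monicGcd_dvd_right u w
  -- By the relation G² divides d v², and d is squarefree.
  have hv : monicGcd u w ∣ v := by
    refine dvd_of_sq_dvd h.squarefree_d hG.ne_zero ?_
    rw [show d * v ^ 2 = u ^ 2 * f₁ +
      Polynomial.C ((-C.f.leadingCoeff) ^ a.natDegree) * a₁ * w ^ 2 by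
        rw [hmin.isSolution.relation h]; ring]
    exact dvd_add ((pow_dvd_pow_of_dvd (monicGcd_dvd_left u w) 2).mul_right _)
      ((pow_dvd_pow_of_dvd (monicGcd_dvd_right u w) 2).mul_left _)
  obtain ⟨v₁, hv₁⟩ := hv
  refine ⟨u₁, v₁, w₁, hu₁, hv₁, hw₁, h, ?_, hG, isCoprime_of_eq_monicGcd_mul hw.ne_zero hu₁ hw₁⟩
  rwa [← hu₁, ← hv₁, ← hw₁]

namespace IsReducedSolution

variable {G u₁ v₁ w₁ : k[X]}

/-- This is d times the relation with G² cancelled: the norm of v₁ d - u₁ y is γ a w₁². -/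
theorem norm_eq (h : C.IsReducedSolution a b d a₁ f₁ s G u₁ v₁ w₁) :
    Polynomial.C ((-C.f.leadingCoeff) ^ a.natDegree) * (a * w₁ ^ 2) =
      (v₁ * d) ^ 2 - u₁ ^ 2 * C.f := by
  have hrel := h.minimal.isSolution.relation h.datum
  refine mul_left_cancel₀ (pow_ne_zero 2 h.monic.ne_zero) ?_
  linear_combination d * hrel + G ^ 2 * u₁ ^ 2 * h.datum.eq_f +
    G ^ 2 * Polynomial.C ((-C.f.leadingCoeff) ^ a.natDegree) * w₁ ^ 2 * h.datum.eq_a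

/-- A common divisor e of u₁ and v₁ d has e² ∣ a w₁², so e ∣ w₁ since a is squarefree; but u₁ and w₁
are coprime. -/
theorem isCoprime_u₁ (h : C.IsReducedSolution a b d a₁ f₁ s G u₁ v₁ w₁) :
    IsCoprime u₁ (a * w₁ ^ 2) := by
  have hγ := C.isUnit_C_neg_leadingCoeff_pow a.natDegree
  have hn := h.norm_eq
  set γ := Polynomial.C ((-C.f.leadingCoeff) ^ a.natDegree)
  have hw₁ : w₁ ≠ 0 := right_ne_zero_of_mul h.minimal.isSolution.monic.ne_zero
  have h1 : IsCoprime u₁ (v₁ * d) := by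
    refine isCoprime_of_dvd _ _ ?_ fun e he he0 hu hv => he ?_
    · rintro ⟨hu, hv⟩
      rw [hu, hv] at hn
      simp [hγ.ne_zero, h.datum.monic.ne_zero, hw₁] at hn
    · have h2 : e ^ 2 ∣ a * w₁ ^ 2 := by
        rw [← hγ.dvd_mul_left, hn]
        exact dvd_sub (pow_dvd_pow_of_dvd hv 2) ((pow_dvd_pow_of_dvd hu 2).mul_right _)
      exact h.isCoprime.isUnit_of_dvd' hu (dvd_of_sq_dvd h.datum.squarefree he0 h2)
  have h2 : IsCoprime u₁ (γ * (a * w₁ ^ 2)) := by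
    rw [hn, show (v₁ * d) ^ 2 - u₁ ^ 2 * C.f = (v₁ * d) ^ 2 + u₁ * (-(u₁ * C.f)) by ring]
    exact h1.pow_right.add_mul_left_right _
  exact h2.of_mul_right_right

/-- A common prime p of w₁ and f divides v₁ d, so p² divides f u₁² and p divides u₁. This allows w₁
to be cancelled when recovering s modulo f. -/
theorem isCoprime_w₁_f (h : C.IsReducedSolution a b d a₁ f₁ s G u₁ v₁ w₁) :
    IsCoprime w₁ C.f := by
  have hn := h.norm_eq
  refine isCoprime_of_prime_dvd (fun h0 => C.f_ne_zero h0.2) fun p hp hw hf => hp.not_isUnit ?_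
  have hv : p ∣ v₁ * d := by
    refine hp.dvd_of_dvd_pow (n := 2) ?_
    rw [show (v₁ * d) ^ 2 = Polynomial.C ((-C.f.leadingCoeff) ^ a.natDegree) * (a * w₁ ^ 2)
      + u₁ ^ 2 * C.f by rw [hn]; ring]
    exact dvd_add (((hw.pow (by simp)).mul_left _).mul_left _) (hf.mul_left _)
  have hu : p ∣ u₁ := by
    refine dvd_of_sq_dvd C.squarefree hp.ne_zero ?_
    rw [show C.f * u₁ ^ 2 = (v₁ * d) ^ 2 -
      Polynomial.C ((-C.f.leadingCoeff) ^ a.natDegree) * (a * w₁ ^ 2) by rw [hn]; ring]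
    exact dvd_sub (pow_dvd_pow_of_dvd hv 2) (((pow_dvd_pow_of_dvd hw 2).mul_left _).mul_left _)
  exact h.isCoprime.isUnit_of_dvd' hu hw

theorem eq_one_of_eq_mul (h : C.IsReducedSolution a b d a₁ f₁ s G u₁ v₁ w₁) {e G' : k[X]}
    (he : e.Monic) (hG : G = e * G') (h1 : f₁ ∣ G' * (v₁ * d - w₁ * s))
    (h2 : a₁ ∣ G' * (v₁ * d - u₁ * b)) (h3 : d ∣ G' * (u₁ * f₁ - w₁ * s)) : e = 1 := by
  subst hG
  refine h.minimal.eq_one_of_eq_mul he (mul_assoc e G' u₁) (mul_assoc e G' v₁)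
    (mul_assoc e G' w₁) ?_ ?_ ?_
  · convert h1 using 1; ring
  · convert h2 using 1; ring
  · convert h3 using 1; ring

theorem f₁_dvd (h : C.IsReducedSolution a b d a₁ f₁ s G u₁ v₁ w₁) :
    f₁ ∣ G * (v₁ * d - w₁ * s) := by
  convert h.minimal.isSolution.congr_f₁ using 1; ring

theorem a₁_dvd (h : C.IsReducedSolution a b d a₁ f₁ s G u₁ v₁ w₁) :
    a₁ ∣ G * (v₁ * d - u₁ * b) := by
  convert h.minimal.isSolution.congr_a₁ using 1; ring

theorem d_dvd (h : C.IsReducedSolution a b d a₁ f₁ s G u₁ v₁ w₁) :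
    d ∣ G * (u₁ * f₁ - w₁ * s) := by
  convert h.minimal.isSolution.congr_d using 1; ring

theorem dvd_f_mul_a₁ (h : C.IsReducedSolution a b d a₁ f₁ s G u₁ v₁ w₁) : G ∣ C.f * a₁ := by
  have hf := h.datum.eq_f
  have hne : C.f * a₁ ≠ 0 := mul_ne_zero C.f_ne_zero h.datum.squarefree_a₁.ne_zero
  obtain ⟨e, he⟩ := monicGcd_dvd_left G (C.f * a₁)
  have hm : (monicGcd G (C.f * a₁)).Monic := monic_monicGcd hne
  -- The cofactor e of gcd(G, f a₁) in G is not needed for any of the three congruences, so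
  -- minimality makes it trivial.
  have he1 : e = 1 := by
    refine h.eq_one_of_eq_mul (hm.of_mul_monic_left (he ▸ h.monic)) (he.trans (mul_comm _ _))
      (dvd_monicGcd_mul ?_ h.f₁_dvd) (dvd_monicGcd_mul ?_ h.a₁_dvd) (dvd_monicGcd_mul ?_ h.d_dvd)
    · exact (Dvd.intro_left _ hf.symm).mul_right _
    · exact dvd_mul_left _ _
    · exact (Dvd.intro _ hf.symm).mul_right _
  rw [he1, mul_one] at he
  rw [he]
  exact monicGcd_dvd_right _ _

theorem eq_mul (h : C.IsReducedSolution a b d a₁ f₁ s G u₁ v₁ w₁) :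
    G = monicGcd G C.f * monicGcd G a₁ :=
  eq_monicGcd_mul_monicGcd h.monic C.f_ne_zero h.datum.squarefree_a₁.ne_zero
    h.datum.isCoprime_f_a₁ h.dvd_f_mul_a₁

/-- A common factor of gcd(G,a₁) and v₁ d - u₁ b could be cancelled from the solution, so minimality
makes these coprime. As (v₁ d)² ≡ (u₁ b)² modulo a₁, the other factor v₁ d + u₁ b must vanish modulo
gcd(G,a₁). The analogues for f₁ and d follow the same pattern. -/
theorem monicGcd_a₁_dvd (h : C.IsReducedSolution a b d a₁ f₁ s G u₁ v₁ w₁) :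
    monicGcd G a₁ ∣ v₁ * d + u₁ * b := by
  have ha₁ := h.datum.squarefree_a₁
  have hga := monicGcd_dvd_right G a₁
  have hcop : IsCoprime (v₁ * d - u₁ * b) (monicGcd G a₁) := by
    refine isCoprime_of_monicGcd_eq_one ?_
    set e := monicGcd (v₁ * d - u₁ * b) (monicGcd G a₁)
    have he : e.Monic := monic_monicGcd (monic_monicGcd ha₁.ne_zero).ne_zero
    have hea : e ∣ a₁ := (monicGcd_dvd_right _ _).trans hga
    obtain ⟨G', hG'⟩ : e ∣ G := (monicGcd_dvd_right _ _).trans (monicGcd_dvd_left G a₁)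
    have h1 := h.f₁_dvd
    have h2 := h.a₁_dvd
    have h3 := h.d_dvd
    rw [hG', mul_assoc] at h1 h2 h3
    exact h.eq_one_of_eq_mul he hG'
      ((h.datum.isCoprime_a₁_f₁.symm.of_isCoprime_of_dvd_right hea).dvd_of_dvd_mul_left h1)
      (dvd_of_dvd_mul_of_squarefree ha₁ hea h2 ((monicGcd_dvd_left _ _).mul_left _))
      ((h.datum.isCoprime_d_a₁.of_isCoprime_of_dvd_right hea).dvd_of_dvd_mul_left h3)
  refine hcop.symm.dvd_of_dvd_mul_left ?_
  rw [show (v₁ * d - u₁ * b) * (v₁ * d + u₁ * b) =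
    (v₁ * d) ^ 2 - u₁ ^ 2 * C.f + u₁ ^ 2 * (C.f - b ^ 2) by ring, ← h.norm_eq]
  refine hga.trans (dvd_add ((Dvd.dvd.mul_right ?_ _).mul_left _) (h.datum.a₁_dvd.mul_left _))
  exact Dvd.intro_left _ h.datum.eq_a.symm

theorem monicGcd_f₁_dvd (h : C.IsReducedSolution a b d a₁ f₁ s G u₁ v₁ w₁) :
    monicGcd G f₁ ∣ v₁ * d + w₁ * s := by
  have hf₁ := h.datum.squarefree_f₁
  have hgf := monicGcd_dvd_right G f₁
  have hcop : IsCoprime (v₁ * d - w₁ * s) (monicGcd G f₁) := by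
    refine isCoprime_of_monicGcd_eq_one ?_
    set e := monicGcd (v₁ * d - w₁ * s) (monicGcd G f₁)
    have he : e.Monic := monic_monicGcd (monic_monicGcd hf₁.ne_zero).ne_zero
    have hef : e ∣ f₁ := (monicGcd_dvd_right _ _).trans hgf
    obtain ⟨G', hG'⟩ : e ∣ G := (monicGcd_dvd_right _ _).trans (monicGcd_dvd_left G f₁)
    have h1 := h.f₁_dvd
    have h2 := h.a₁_dvd
    have h3 := h.d_dvd
    rw [hG', mul_assoc] at h1 h2 h3
    exact h.eq_one_of_eq_mul he hG'
      (dvd_of_dvd_mul_of_squarefree hf₁ hef h1 ((monicGcd_dvd_left _ _).mul_left _))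
      ((h.datum.isCoprime_a₁_f₁.of_isCoprime_of_dvd_right hef).dvd_of_dvd_mul_left h2)
      ((h.datum.isCoprime_d_f₁.of_isCoprime_of_dvd_right hef).dvd_of_dvd_mul_left h3)
  refine hcop.symm.dvd_of_dvd_mul_left (hgf.trans ?_)
  have hn := h.norm_eq
  have h1 := h.datum.f₁_dvd
  set γ := Polynomial.C ((-C.f.leadingCoeff) ^ a.natDegree)
  rw [← h.datum.eq_a] at h1
  rw [show (v₁ * d - w₁ * s) * (v₁ * d + w₁ * s) =
    (γ * a - s ^ 2) * w₁ ^ 2 + f₁ * (u₁ ^ 2 * d) by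
      linear_combination u₁ ^ 2 * h.datum.eq_f - hn]
  exact dvd_add (h1.mul_right _) (dvd_mul_right _ _)

theorem monicGcd_d_dvd (h : C.IsReducedSolution a b d a₁ f₁ s G u₁ v₁ w₁) :
    monicGcd G d ∣ u₁ * f₁ + w₁ * s := by
  have hd := h.datum.squarefree_d
  have hgd := monicGcd_dvd_right G d
  have hcop : IsCoprime (u₁ * f₁ - w₁ * s) (monicGcd G d) := by
    refine isCoprime_of_monicGcd_eq_one ?_
    set e := monicGcd (u₁ * f₁ - w₁ * s) (monicGcd G d)
    have he : e.Monic := monic_monicGcd (monic_monicGcd hd.ne_zero).ne_zero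
    have hed : e ∣ d := (monicGcd_dvd_right _ _).trans hgd
    obtain ⟨G', hG'⟩ : e ∣ G := (monicGcd_dvd_right _ _).trans (monicGcd_dvd_left G d)
    have h1 := h.f₁_dvd
    have h2 := h.a₁_dvd
    have h3 := h.d_dvd
    rw [hG', mul_assoc] at h1 h2 h3
    exact h.eq_one_of_eq_mul he hG'
      ((h.datum.isCoprime_d_f₁.symm.of_isCoprime_of_dvd_right hed).dvd_of_dvd_mul_left h1)
      ((h.datum.isCoprime_d_a₁.symm.of_isCoprime_of_dvd_right hed).dvd_of_dvd_mul_left h2)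
      (dvd_of_dvd_mul_of_squarefree hd hed h3 ((monicGcd_dvd_left _ _).mul_left _))
  refine hcop.symm.dvd_of_dvd_mul_left (hgd.trans ?_)
  have hn : Polynomial.C ((-C.f.leadingCoeff) ^ a.natDegree) * a₁ * w₁ ^ 2 =
      v₁ ^ 2 * d - u₁ ^ 2 * f₁ := by
    refine mul_left_cancel₀ hd.ne_zero ?_
    linear_combination h.norm_eq - u₁ ^ 2 * h.datum.eq_f -
      Polynomial.C ((-C.f.leadingCoeff) ^ a.natDegree) * w₁ ^ 2 * h.datum.eq_a
  have h1 := h.datum.d_dvd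
  set γ := Polynomial.C ((-C.f.leadingCoeff) ^ a.natDegree)
  rw [show (u₁ * f₁ - w₁ * s) * (u₁ * f₁ + w₁ * s) =
    d * (v₁ ^ 2 * f₁) - (γ * (a₁ * f₁) + s ^ 2) * w₁ ^ 2 by linear_combination f₁ * hn]
  exact dvd_sub (dvd_mul_right _ _) (h1.mul_right _)

/-- The solution determines the square root of `(-c) ^ deg a * (a - a₁ * f₁)` modulo `f`. -/
theorem dvd_sub_of_same {s' : k[X]} (h : C.IsReducedSolution a b d a₁ f₁ s G u₁ v₁ w₁)
    (h' : C.IsReducedSolution a b d a₁ f₁ s' G u₁ v₁ w₁) : C.f ∣ s' - s := by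
  have hcop := h.isCoprime_w₁_f
  rw [h.datum.eq_f] at hcop ⊢
  -- Subtracting the congruences for s and s' determines w₁ s up to the factor G; on the gcds with G
  -- the sign-reversed congruences supply the rest.
  refine h.datum.isCoprime_d_f₁.mul_dvd
    (dvd_of_dvd_monicGcd_mul h.datum.squarefree_d (hcop.of_mul_right_left) (G := G) ?_ ?_)
    (dvd_of_dvd_monicGcd_mul h.datum.squarefree_f₁ (hcop.of_mul_right_right) (G := G) ?_ ?_)
  · convert dvd_sub h.d_dvd h'.d_dvd using 1; ring
  · convert dvd_sub h'.monicGcd_d_dvd h.monicGcd_d_dvd using 1; ring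
  · convert dvd_sub h.f₁_dvd h'.f₁_dvd using 1; ring
  · convert dvd_sub h'.monicGcd_f₁_dvd h.monicGcd_f₁_dvd using 1; ring

end IsReducedSolution

end OddHyperellipticCurve

/-! ### The divisor of v d - u y, halving, and distinctness of the halves. -/

namespace OddHyperellipticCurve

variable {k : Type*} [Field k] {C : OddHyperellipticCurve k} {a b d a₁ f₁ s : k[X]}

theorem isMumfordR_iff {u v w r u₁ v₁ w₁ : k[X]} (hG : monicGcd u w ≠ 0)
    (hu : u = monicGcd u w * u₁) (hv : v = monicGcd u w * v₁) (hw : w = monicGcd u w * w₁) :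
    C.IsMumfordR d a₁ u v w r ↔ w₁ * monicGcd (monicGcd u w) a₁ ∣ r * u₁ + v₁ * d ∧
      monicGcd (monicGcd u w) C.f ∣ r := by
  rw [IsMumfordR, ← EuclideanDomain.eq_div_of_mul_eq_right hG hu.symm,
    ← EuclideanDomain.eq_div_of_mul_eq_right hG hv.symm,
    ← EuclideanDomain.eq_div_of_mul_eq_right hG hw.symm, sub_neg_eq_add]

namespace IsReducedSolution

variable {G u₁ v₁ w₁ r : k[X]}

theorem isCoprime_u₁_w₁_mul (h : C.IsReducedSolution a b d a₁ f₁ s G u₁ v₁ w₁) :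
    IsCoprime u₁ (w₁ * monicGcd G a₁) := by
  refine h.isCoprime_u₁.of_isCoprime_of_dvd_right ?_
  rw [mul_comm, h.datum.eq_a]
  exact mul_dvd_mul ((monicGcd_dvd_right _ _).mul_left _) (dvd_pow_self _ (by simp))

theorem isCoprime_monicGcd_f (h : C.IsReducedSolution a b d a₁ f₁ s G u₁ v₁ w₁) :
    IsCoprime (monicGcd G C.f) (w₁ * monicGcd G a₁) :=
  (h.isCoprime_w₁_f.symm.mul_right (h.datum.isCoprime_f_a₁.of_isCoprime_of_dvd_right
    (monicGcd_dvd_right _ _))).of_isCoprime_of_dvd_left (monicGcd_dvd_right _ _)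

/-- The Chinese remainder theorem: u₁ is invertible modulo w₁ d_a, which is coprime to d_f. -/
theorem exists_r (h : C.IsReducedSolution a b d a₁ f₁ s G u₁ v₁ w₁) :
    ∃ r, w₁ * monicGcd G a₁ ∣ r * u₁ + v₁ * d ∧ monicGcd G C.f ∣ r := by
  obtain ⟨x, y, hxy⟩ := h.isCoprime_u₁_w₁_mul.mul_left h.isCoprime_monicGcd_f
  refine ⟨-(v₁ * d * x) * monicGcd G C.f, ⟨v₁ * d * y, ?_⟩, dvd_mul_left _ _⟩
  linear_combination -(v₁ * d) * hxy

theorem dvd_f_sub_sq (h : C.IsReducedSolution a b d a₁ f₁ s G u₁ v₁ w₁)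
    (hr : w₁ * monicGcd G a₁ ∣ r * u₁ + v₁ * d) (hr' : monicGcd G C.f ∣ r) :
    G * w₁ ∣ C.f - r ^ 2 := by
  have h1 : monicGcd G C.f ∣ C.f - r ^ 2 :=
    dvd_sub (monicGcd_dvd_right _ _) (hr'.trans (dvd_pow_self _ (by simp)))
  have h2 : w₁ * monicGcd G a₁ ∣ C.f - r ^ 2 := by
    refine (h.isCoprime_u₁_w₁_mul.symm.pow_right (n := 2)).dvd_of_dvd_mul_left ?_
    rw [show u₁ ^ 2 * (C.f - r ^ 2) = (r * u₁ + v₁ * d) * (v₁ * d - r * u₁) -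
      Polynomial.C ((-C.f.leadingCoeff) ^ a.natDegree) * (a * w₁ ^ 2) by rw [h.norm_eq]; ring]
    refine dvd_sub (hr.mul_right _) (Dvd.dvd.mul_left ?_ _)
    rw [mul_comm, h.datum.eq_a]
    exact mul_dvd_mul ((monicGcd_dvd_right _ _).mul_left _) (dvd_pow_self _ (by simp))
  have := h.isCoprime_monicGcd_f.mul_dvd h1 h2
  rw [h.eq_mul]
  convert this using 1
  ring

/-- The divisor of the function `v d - u y` on the affine part of the curve is
`(a, b) + 2 (w, -r)`. -/
theorem span_eq (h : C.IsReducedSolution a b d a₁ f₁ s G u₁ v₁ w₁)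
    (hr : w₁ * monicGcd G a₁ ∣ r * u₁ + v₁ * d) (hr' : monicGcd G C.f ∣ r) :
    Ideal.span {(⟨G * v₁ * d, -(G * u₁)⟩ : C.CoordinateRing)} =
      C.mumfordIdeal a b * C.mumfordIdeal (G * w₁) (-r) ^ 2 := by
  have hw := h.dvd_f_sub_sq hr hr'
  have hG := h.eq_mul
  have hda := h.monicGcd_a₁_dvd
  have hcop := h.isCoprime_u₁
  obtain ⟨a₂, ha₂⟩ := monicGcd_dvd_right G a₁
  have hcop₂ : IsCoprime a₂ G := by
    have h1 : IsCoprime a₂ (monicGcd G a₁) :=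
      (Squarefree.isCoprime_of_mul (ha₂ ▸ h.datum.squarefree_a₁)).symm
    have h2 : IsCoprime a₂ (monicGcd G C.f) :=
      (h.datum.isCoprime_f_a₁.symm.of_isCoprime_of_dvd_left
        (Dvd.intro_left _ ha₂.symm)).of_isCoprime_of_dvd_right (monicGcd_dvd_right _ _)
    rw [hG]
    exact h2.mul_right h1
  set D := monicGcd G a₁
  set E := monicGcd G C.f
  have ha : a = d * a₂ * D := by rw [h.datum.eq_a, ha₂]; ring
  have hGw : G * w₁ = E * (D * w₁) := by rw [← mul_assoc, ← hG]
  obtain ⟨x, y, hxy⟩ := hcop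
  -- Here x inverts u₁ modulo a w₁², so t = v₁ d / u₁ is the value of y on the zeros of v₁ d - u₁ y.
  have ht : a * w₁ ^ 2 ∣ v₁ * d - u₁ * (x * (v₁ * d)) := ⟨y * (v₁ * d), by
    linear_combination (-(v₁ * d)) * hxy⟩
  set t := x * (v₁ * d)
  obtain ⟨hNt, hspan⟩ := C.span_singleton_eq_mumfordIdeal
    (C.isUnit_C_neg_leadingCoeff_pow a.natDegree) h.norm_eq h.isCoprime_u₁ ht
  have hcong : ∀ {m c : k[X]}, m ∣ a * w₁ ^ 2 → m ∣ v₁ * d - u₁ * c →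
      C.mumfordIdeal m t = C.mumfordIdeal m c := fun {m c} hm hc => by
    refine C.mumfordIdeal_congr ?_
    refine (h.isCoprime_u₁.of_isCoprime_of_dvd_right hm).symm.dvd_of_dvd_mul_left ?_
    rw [show u₁ * (t - c) = (v₁ * d - u₁ * c) - (v₁ * d - u₁ * t) by ring]
    exact dvd_sub hc (hm.trans ht)
  have hDa : D ∣ a := Dvd.intro_left _ ha.symm
  have hw₁ : C.mumfordIdeal w₁ t = C.mumfordIdeal w₁ (-r) := by
    refine hcong ((dvd_pow_self _ (by simp)).mul_left _) ?_
    convert (dvd_mul_right w₁ D).trans hr using 1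
    ring
  have hD : C.mumfordIdeal D t = C.mumfordIdeal D (-r) := by
    refine hcong (hDa.mul_right _) ?_
    convert (dvd_mul_left D w₁).trans hr using 1
    ring
  -- Modulo d both v₁ d and b vanish; modulo a₂ = a₁ / d_a the factor G can be cancelled from the
  -- original congruence.
  have hda₂ : C.mumfordIdeal (d * a₂) t = C.mumfordIdeal (d * a₂) b := by
    refine hcong ((Dvd.intro _ ha.symm).mul_right _) ?_
    have hcda : IsCoprime d a₂ := h.datum.isCoprime_d_a₁.of_isCoprime_of_dvd_right
      (Dvd.intro_left _ ha₂.symm)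
    refine hcda.mul_dvd (dvd_sub (dvd_mul_left _ _) (h.datum.d_dvd_b.mul_left _)) ?_
    exact hcop₂.dvd_of_dvd_mul_left ((Dvd.intro_left _ ha₂.symm).trans h.a₁_dvd)
  -- The reversed sign modulo d_a gives b ≡ r there, whereas t ≡ -r.
  have hDb : C.mumfordIdeal D b = C.mumfordIdeal D r := by
    refine C.mumfordIdeal_congr ?_
    have hcD : IsCoprime D u₁ := (h.isCoprime_u₁.of_isCoprime_of_dvd_right (hDa.mul_right _)).symm
    refine hcD.dvd_of_dvd_mul_left ?_
    convert dvd_sub hda ((dvd_mul_left D w₁).trans hr) using 1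
    ring
  have hE : C.mumfordIdeal E r = C.mumfordIdeal E (-r) := by
    refine C.mumfordIdeal_congr ?_
    rw [sub_neg_eq_add]
    exact dvd_add hr' hr'
  have hwn : G * w₁ ∣ C.f - (-r) ^ 2 := by rwa [neg_sq]
  have hEf : E ∣ C.f - r ^ 2 := (Dvd.intro _ hGw.symm).trans hw
  have hDf : D ∣ C.f - r ^ 2 := ((dvd_mul_right D w₁).mul_left E).trans (hGw ▸ hw)
  have i1 : C.mumfordIdeal (G * w₁) (-r) =
      C.mumfordIdeal E (-r) * (C.mumfordIdeal D (-r) * C.mumfordIdeal w₁ (-r)) := by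
    rw [hGw] at hwn ⊢
    rw [C.mumfordIdeal_mul ((dvd_mul_left _ _).trans hwn), C.mumfordIdeal_mul hwn]
  have i2 : C.mumfordIdeal a b = C.mumfordIdeal (d * a₂) b * C.mumfordIdeal D r := by
    rw [← hDb, C.mumfordIdeal_mul (ha ▸ h.datum.dvd), ← ha]
  have i3 : Ideal.span {(⟨v₁ * d, -u₁⟩ : C.CoordinateRing)} =
      C.mumfordIdeal (d * a₂) b * C.mumfordIdeal D (-r) * C.mumfordIdeal w₁ (-r) ^ 2 := by
    have hNt' : w₁ * w₁ ∣ C.f - t ^ 2 := by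
      rw [← pow_two]
      exact (dvd_mul_left _ _).trans hNt
    have hat : d * a₂ * D ∣ C.f - t ^ 2 := by
      rw [← ha]
      exact (dvd_mul_right _ _).trans hNt
    rw [hspan, ← hda₂, ← hD, ← hw₁, C.mumfordIdeal_mul hat, ← ha,
      pow_two (C.mumfordIdeal w₁ t), C.mumfordIdeal_mul hNt', ← pow_two, C.mumfordIdeal_mul hNt]
  have i4 : (⟨G * v₁ * d, -(G * u₁)⟩ : C.CoordinateRing) =
      algebraMap k[X] _ E * algebraMap k[X] _ D * ⟨v₁ * d, -u₁⟩ := by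
    rw [← map_mul, ← hG]
    refine QuadraticAlgebra.ext ?_ ?_ <;> simp
    ring
  -- Multiplying by G = E D restores the missing factors: (D) = (D,r)(D,-r) completes (a,b) and
  -- squares (D,-r), and (E) = (E,-r)² because r ≡ 0 modulo E.
  rw [i4, ← Ideal.span_singleton_mul_span_singleton, ← Ideal.span_singleton_mul_span_singleton, i3,
    ← C.mumfordIdeal_mul_neg hEf, ← C.mumfordIdeal_mul_neg hDf, i1, i2, hE]
  ring

theorem ne_zero (h : C.IsReducedSolution a b d a₁ f₁ s G u₁ v₁ w₁) :
    (⟨G * v₁ * d, -(G * u₁)⟩ : C.CoordinateRing) ≠ 0 := by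
  intro h0
  have hG := h.monic.ne_zero
  have h1 : G * v₁ * d = 0 := congrArg QuadraticAlgebra.re h0
  have h2 : -(G * u₁) = 0 := congrArg QuadraticAlgebra.im h0
  have h3 : v₁ * d = 0 := by simpa [mul_assoc, hG] using h1
  have h4 : u₁ = 0 := by simpa [hG] using h2
  have hn := h.norm_eq
  rw [h3, h4] at hn
  have hw₁ : w₁ ≠ 0 := right_ne_zero_of_mul h.minimal.isSolution.monic.ne_zero
  have := (C.isUnit_C_neg_leadingCoeff_pow a.natDegree).ne_zero
  refine mul_ne_zero this (mul_ne_zero h.datum.monic.ne_zero (pow_ne_zero 2 hw₁)) (hn.trans ?_)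
  ring

theorem mumfordPoint_eq_two_smul (h : C.IsReducedSolution a b d a₁ f₁ s G u₁ v₁ w₁)
    (hr : w₁ * monicGcd G a₁ ∣ r * u₁ + v₁ * d) (hr' : monicGcd G C.f ∣ r) :
    C.mumfordPoint a b = 2 • C.mumfordPoint (G * w₁) r := by
  have hbot : ∀ {p q : k[X]}, C.mumfordIdeal p q ≠ ⊥ := C.mumfordIdeal_ne_bot
  have h1 := C.toJacobian_idealDivisor_span h.ne_zero
  rw [h.span_eq hr hr', pow_two, C.idealDivisor_mul hbot (mul_ne_zero hbot hbot),
    C.idealDivisor_mul hbot hbot, toJacobian_add, toJacobian_add, ← mumfordPoint_eq,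
    ← mumfordPoint_eq] at h1
  have hw := h.minimal.isSolution.monic.ne_zero
  have h2 := C.toJacobian_idealDivisor_span
    (h := algebraMap k[X] C.CoordinateRing (G * w₁)) (by
      rwa [Ne, FaithfulSMul.algebraMap_eq_zero_iff])
  rw [← C.mumfordIdeal_mul_neg (h.dvd_f_sub_sq hr hr'), C.idealDivisor_mul hbot hbot,
    toJacobian_add, ← mumfordPoint_eq, ← mumfordPoint_eq] at h2
  rw [eq_neg_of_add_eq_zero_left h1, eq_neg_of_add_eq_zero_left h2]
  abel

end IsReducedSolution

/-- An ideal determines its generator only up to sign here; this symmetry reduces the negative sign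
to the positive one. -/
theorem IsMinimalSolution.neg {u v w : k[X]} (h : C.IsMinimalSolution a b d a₁ f₁ s u v w) :
    C.IsMinimalSolution a b d a₁ f₁ (-s) (-u) (-v) w := by
  have key : ∀ {s u v w : k[X]}, C.IsSolution a b d a₁ f₁ s u v w →
      C.IsSolution a b d a₁ f₁ (-s) (-u) (-v) w := fun {s u v w} h => by
    refine ⟨?_, ?_, ?_, h.monic, ?_, ?_, h.degree_w⟩
    · convert h.congr_f₁.neg_right using 1; ring
    · convert h.congr_a₁.neg_right using 1; ring
    · convert h.congr_d.neg_right using 1; ring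
    · simpa using h.degree_u
    · simpa using h.degree_v
  refine ⟨key h.isSolution, fun u' v' w' h' => ?_⟩
  have := key h'
  rw [neg_neg] at this
  exact h.minimal _ _ _ this

theorem IsMinimalSolution.dvd_sub_of_same {u v w s' : k[X]}
    (hmin : C.IsMinimalSolution a b d a₁ f₁ s u v w)
    (hmin' : C.IsMinimalSolution a b d a₁ f₁ s' u v w)
    (h : C.IsHalvingDatum a b d a₁ f₁ s) (h' : C.IsHalvingDatum a b d a₁ f₁ s') :
    C.f ∣ s' - s := by
  obtain ⟨u₁, v₁, w₁, hu, hv, hw, hred⟩ := hmin.exists_isReducedSolution h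
  refine hred.dvd_sub_of_same ⟨h', ?_, hred.monic, hred.isCoprime⟩
  rwa [← hu, ← hv, ← hw]

/-- Solutions with the same `w` that define the same ideal agree up to a common sign. -/
theorem IsSolution.eq_or_eq_neg {u v u' v' w s' : k[X]}
    (hsol : C.IsSolution a b d a₁ f₁ s u v w) (hsol' : C.IsSolution a b d a₁ f₁ s' u' v' w)
    (h : C.IsHalvingDatum a b d a₁ f₁ s) (h' : C.IsHalvingDatum a b d a₁ f₁ s')
    (hspan : Ideal.span {(⟨v * d, -u⟩ : C.CoordinateRing)} = Ideal.span {⟨v' * d, -u'⟩}) :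
    u' = u ∧ v' = v ∨ u' = -u ∧ v' = -v := by
  rw [Ideal.span_singleton_eq_span_singleton] at hspan
  obtain ⟨z, hz⟩ := hspan
  obtain ⟨c, hc⟩ := C.exists_eq_algebraMap_C_of_isUnit z.isUnit
  rw [hc] at hz
  have hu : u' = Polynomial.C c * u := by
    have := congrArg QuadraticAlgebra.im hz
    simp at this
    rw [← this, mul_comm]
  have hv : v' = Polynomial.C c * v := by
    have := congrArg QuadraticAlgebra.re hz
    simp at this
    exact mul_right_cancel₀ h.squarefree_d.ne_zero (by linear_combination -this)
  have hrel := hsol.relation h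
  have hrel' := hsol'.relation h'
  have hγ := (C.isUnit_C_neg_leadingCoeff_pow a.natDegree).ne_zero
  have hne := mul_ne_zero (mul_ne_zero hγ h.squarefree_a₁.ne_zero)
    (pow_ne_zero 2 hsol.monic.ne_zero)
  -- The relation is homogeneous quadratic in (u,v) apart from the nonzero term γ a₁ w², which both
  -- solutions share.
  have hc2 : Polynomial.C c ^ 2 = 1 := by
    refine mul_right_cancel₀ hne ?_
    rw [hu, hv] at hrel'
    linear_combination Polynomial.C c ^ 2 * hrel - hrel'
  rcases sq_eq_one_iff.mp hc2 with h1 | h1 <;> rw [hu, hv, h1]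
  · exact Or.inl ⟨one_mul _, one_mul _⟩
  · exact Or.inr ⟨neg_one_mul _, neg_one_mul _⟩

theorem mumfordPoint_ne_of_isMinimalSolution {u v w r u' v' w' r' s' : k[X]}
    (h : C.IsHalvingDatum a b d a₁ f₁ s) (h' : C.IsHalvingDatum a b d a₁ f₁ s')
    (hsub : ¬ C.f ∣ s' - s) (hadd : ¬ C.f ∣ s' + s)
    (hmin : C.IsMinimalSolution a b d a₁ f₁ s u v w) (hr : C.IsMumfordR d a₁ u v w r)
    (hmin' : C.IsMinimalSolution a b d a₁ f₁ s' u' v' w') (hr' : C.IsMumfordR d a₁ u' v' w' r') :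
    C.mumfordPoint w r ≠ C.mumfordPoint w' r' := by
  intro heq
  have hspan : ∀ {s u v w r : k[X]}, C.IsHalvingDatum a b d a₁ f₁ s →
      C.IsMinimalSolution a b d a₁ f₁ s u v w → C.IsMumfordR d a₁ u v w r →
      w ∣ C.f - r ^ 2 ∧ Ideal.span {(⟨v * d, -u⟩ : C.CoordinateRing)} =
        C.mumfordIdeal a b * C.mumfordIdeal w (-r) ^ 2 := fun {s u v w r} h hmin hr => by
    obtain ⟨u₁, v₁, w₁, hu, hv, hw, hred⟩ := hmin.exists_isReducedSolution h
    rw [isMumfordR_iff hred.monic.ne_zero hu hv hw] at hr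
    have h1 := hred.dvd_f_sub_sq hr.1 hr.2
    have h2 := hred.span_eq hr.1 hr.2
    rw [← hw] at h1 h2
    rw [← hu, ← hv] at h2
    exact ⟨h1, h2⟩
  obtain ⟨h1, h2⟩ := hspan h hmin hr
  obtain ⟨h1', h2'⟩ := hspan h' hmin' hr'
  have hsol := hmin.isSolution
  have hsol' := hmin'.isSolution
  obtain ⟨rfl, hrr⟩ := C.eq_and_dvd_of_mumfordIdeal_eq hsol.monic hsol'.monic h1 h1'
    (C.mumfordIdeal_eq_of_mumfordPoint_eq hsol.monic hsol'.monic h1 h1' hsol.degree_w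
      hsol'.degree_w heq)
  have hneg : C.mumfordIdeal w (-r) = C.mumfordIdeal w (-r') := by
    refine C.mumfordIdeal_congr ?_
    convert hrr.neg_right using 1
    ring
  rw [hneg, ← h2'] at h2
  rcases hsol.eq_or_eq_neg hsol' h h' h2 with ⟨rfl, rfl⟩ | ⟨rfl, rfl⟩
  · exact hsub (hmin.dvd_sub_of_same hmin' h h')
  · have hneg' := hmin'.neg
    rw [neg_neg, neg_neg] at hneg'
    have hd' : C.IsHalvingDatum a b d a₁ f₁ (-s') :=
      { h' with isSqrt := by rw [IsSqrt, neg_sq]; exact h'.isSqrt }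
    have := (hmin.dvd_sub_of_same hneg' h hd').neg_right
    refine hadd ?_
    convert this using 1
    ring

end OddHyperellipticCurve

/-! ### Assembly of the statements. -/

theorem propositionP {k : Type*} [Field k] (C : OddHyperellipticCurve k)
    (a b d a₁ f₁ s : k[X]) (ha : a.Monic) (ha' : Squarefree a) (hdeg : a.natDegree ≤ 2 * C.g + 1)
    (hd : d = monicGcd a C.f) (had : a = d * a₁) (hfd : C.f = d * f₁)
    (hb : a ∣ C.f - b ^ 2) (hs : C.IsSqrt a a₁ f₁ s) :
    -- the point `P = [a, b]` lies in `2 J(k)`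
    (∃ Q : C.Jacobian, C.mumfordPoint a b = 2 • Q) ∧
    -- the system has a solution within the degree bounds
    (∃ u v w : k[X], C.IsSolution a b d a₁ f₁ s u v w) ∧
    -- each solution satisfies the relation
    (∀ u v w : k[X], C.IsSolution a b d a₁ f₁ s u v w →
      u ^ 2 * f₁ = d * v ^ 2 -
        Polynomial.C ((-C.f.leadingCoeff) ^ a.natDegree) * a₁ * w ^ 2) ∧
    -- a solution with `w` of minimal degree gives `Q = [w, r]` with `P = 2 Q`
    (∀ u v w : k[X], C.IsMinimalSolution a b d a₁ f₁ s u v w →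
      monicGcd u w ∣ C.f * a₁ ∧
      monicGcd u w ∣ v ∧
      monicGcd u w = monicGcd (monicGcd u w) C.f * monicGcd (monicGcd u w) a₁ ∧
      (∃ r : k[X], C.IsMumfordR d a₁ u v w r) ∧
      ∀ r : k[X], C.IsMumfordR d a₁ u v w r →
        w ∣ C.f - r ^ 2 ∧ C.mumfordPoint a b = 2 • C.mumfordPoint w r) ∧
    -- if `s' ≢ ± s mod f`, then the points obtained from `s` and `s'` are distinct
    (∀ s' : k[X], C.IsSqrt a a₁ f₁ s' → ¬ C.f ∣ s' - s → ¬ C.f ∣ s' + s →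
      ∀ u v w r u' v' w' r' : k[X],
        C.IsMinimalSolution a b d a₁ f₁ s u v w → C.IsMumfordR d a₁ u v w r →
        C.IsMinimalSolution a b d a₁ f₁ s' u' v' w' → C.IsMumfordR d a₁ u' v' w' r' →
        C.mumfordPoint w r ≠ C.mumfordPoint w' r') := by
  have datum := OddHyperellipticCurve.IsHalvingDatum.of_monicGcd ha ha' hdeg hd had hfd hb hs
  have main : ∀ u v w : k[X], C.IsMinimalSolution a b d a₁ f₁ s u v w →
      monicGcd u w ∣ C.f * a₁ ∧
      monicGcd u w ∣ v ∧
      monicGcd u w = monicGcd (monicGcd u w) C.f * monicGcd (monicGcd u w) a₁ ∧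
      (∃ r : k[X], C.IsMumfordR d a₁ u v w r) ∧
      ∀ r : k[X], C.IsMumfordR d a₁ u v w r →
        w ∣ C.f - r ^ 2 ∧ C.mumfordPoint a b = 2 • C.mumfordPoint w r := by
    intro u v w hmin
    obtain ⟨u₁, v₁, w₁, hu, hv, hw, hred⟩ := hmin.exists_isReducedSolution datum
    have hiff : ∀ r, C.IsMumfordR d a₁ u v w r ↔ _ := fun r =>
      OddHyperellipticCurve.isMumfordR_iff hred.monic.ne_zero hu hv hw
    refine ⟨hred.dvd_f_mul_a₁, ⟨v₁, hv⟩, hred.eq_mul, ?_, fun r hr => ?_⟩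
    · obtain ⟨r, hr⟩ := hred.exists_r
      exact ⟨r, (hiff r).mpr hr⟩
    · obtain ⟨hr₁, hr₂⟩ := (hiff r).mp hr
      have h1 := hred.dvd_f_sub_sq hr₁ hr₂
      have h2 := hred.mumfordPoint_eq_two_smul hr₁ hr₂
      rw [← hw] at h1 h2
      exact ⟨h1, h2⟩
  refine ⟨?_, datum.exists_isSolution, fun u v w hsol => hsol.relation datum, main, ?_⟩
  · obtain ⟨u, v, w, hmin⟩ := datum.exists_isMinimalSolution
    obtain ⟨_, _, _, ⟨r, hr⟩, hQ⟩ := main u v w hmin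
    exact ⟨_, (hQ r hr).2⟩
  · intro s' hs' hsub hadd u v w r u' v' w' r' hmin hr hmin' hr'
    exact OddHyperellipticCurve.mumfordPoint_ne_of_isMinimalSolution datum
      { datum with isSqrt := hs' } hsub hadd hmin hr hmin' hr'
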